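/- Let $(A,\Delta)$ be an algebraic quantum group (AQG): $A$ is a non-degenerate complex $*$-algebra (not necessarily unital), $\Delta:A\to M(A\otimes A)$ is a non-degenerate coassociative $*$-homomorphism into the multiplier algebra of the algebraic tensor product such that $a\otimes b\mapsto\Delta(a)(1\otimes b)$ and $a\otimes b\mapsto(a\otimes 1)\Delta(b)$ are bijections of $A\otimes A$ onto itself, and $\varphi:A\to\mathbb C$ is a non-zero positive left invariant functional, $(\iota\otimes\varphi)\Delta(a)=\varphi(a)1$. Let $\varepsilon$ be the counit. Assume that $(A,\Delta)$ is discrete, i.e. there is a non-zero $h\in A$ with $ah=\varepsilon(a)h$ for all $a\in A$. Then $A\cong\bigoplus_{i\in I}\mathrm{End}\,H_i$ as a $*$-algebra, with non-zero finite dimensional Hilbert spaces $H_i$, and $M(A)\cong\prod_i\mathrm{End}\,H_i$ carries the product topology. Let $\pi_l$ be the left regular representation $\pi_l(a)x=ax$ of $A$ on $A$, with inner product $(x,y)=\varphi(y^*x)$. The space $\mathrm{Hom}(\pi_l,\pi_l)=\{s\in\mathrm{End}_{\mathbb C}A : s(ax)=a\,s(x)\ \forall a,x\in A\}$ is isomorphic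 to the product over $i$ of the finite dimensional spaces of intertwiners of the isotypic components $\mathrm{End}\,H_i$ of $\pi_l$, and carries the product topology; $t^*$ denotes the adjoint of $t$ with respect to $(\cdot,\cdot)$. With the Fourier transform $\mathcal F(a)=\varphi(\,\cdot\,a)$ and the multiplication $\hat m(\omega\otimes\omega')=(\omega\otimes\omega')\Delta$ of the dual $\hat A=\mathcal F(A)$, whose unit is $\varepsilon$, the regular monoid $(\pi_l,\tilde m,\tilde\eta)$ is given by the uniquely determined linear maps $\tilde m=\mathcal F^{-1}\hat m(\mathcal F\otimes\mathcal F):A\otimes A\to A$, i.e. $\varphi(c\,\tilde m(x))=(\varphi\otimes\varphi)(\Delta(c)x)$ for $c\in A$, $x\in A\otimes A$, and $\tilde\eta(1)=\mathcal F^{-1}(\varepsilon)$. Put $$G=\{g\in M(A) : \Delta g=g\otimes g,\ g^*g=gg^*=1\},$$ where $\Delta$ also denotes the extension $M(A)\to M(A\otimes A)$, a group under multiplication, with the topology of $M(A)$, and $$G_{\pi_l}=\{t\in\mathrm{Hom}(\pi_l,\pi_l) : t\circ t^*=t^*\circ t=\mathrm{id},\ \tilde m\circ(t\otimes t)=t\circ\tilde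 m\},$$ a group under composition, with the topology of $\mathrm{Hom}(\pi_l,\pi_l)$. Then $G$ and $G_{\pi_l}$ are topological groups, $G$ is compact, and $G\cong G_{\pi_l}$ as topological groups. -/

import Mathlib

open scoped TensorProduct

universe u

section StarTensor

variable {A : Type u} [NonUnitalRing A] [Module ℂ A] [IsScalarTower ℂ A A] [SMulCommClass ℂ A A]
  [StarRing A] [StarModule ℂ A]

/-- The involution `(a ⊗ b)* = a* ⊗ b*` makes `A ⊗ A` a (possibly non-unital) `*`-ring. -/
noncomputable instance tensorStarRing : StarRing (A ⊗[ℂ] A) where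
  star_mul x y := by
    induction x with
    | zero => simp
    | add x₁ x₂ h₁ h₂ => rw [add_mul, star_add, h₁, h₂, star_add, mul_add]
    | tmul a b =>
      induction y with
      | zero => simp
      | add y₁ y₂ h₁ h₂ => rw [mul_add, star_add, h₁, h₂, star_add, add_mul]
      | tmul c d => simp [Algebra.TensorProduct.tmul_mul_tmul]
  star_add := star_add

end StarTensor

section Multipliers

variable (B : Type u) [NonUnitalRing B] [Module ℂ B] [IsScalarTower ℂ B B] [SMulCommClass ℂ B B]

/-- The multiplier algebra `M(B)`: pairs `(ψ, ϕ)` of a left multiplier `ψ` and a right multiplier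
`ϕ` with `ϕ(a) b = a ψ(b)`, where `(ψ₁, ϕ₁)(ψ₂, ϕ₂) = (ψ₁ ∘ ψ₂, ϕ₂ ∘ ϕ₁)`. -/
def multiplierAlgebra : Subalgebra ℂ (Module.End ℂ B × (Module.End ℂ B)ᵐᵒᵖ) where
  carrier := {x | (∀ a b, x.1 (a * b) = x.1 a * b) ∧
    (∀ a b, x.2.unop (a * b) = a * x.2.unop b) ∧ ∀ a b, x.2.unop a * b = a * x.1 b}
  mul_mem' := by
    rintro x y ⟨h1, h2, h3⟩ ⟨k1, k2, k3⟩
    refine ⟨fun a b => ?_, fun a b => ?_, fun a b => ?_⟩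
    · simp [k1, h1]
    · simp [k2, h2]
    · simp [k3, h3]
  add_mem' := by
    rintro x y ⟨h1, h2, h3⟩ ⟨k1, k2, k3⟩
    refine ⟨fun a b => ?_, fun a b => ?_, fun a b => ?_⟩
    · simp [k1, h1, add_mul]
    · simp [k2, h2, mul_add]
    · simp [k3, h3, add_mul, mul_add]
  algebraMap_mem' := by
    intro r
    refine ⟨fun a b => ?_, fun a b => ?_, fun a b => ?_⟩ <;>
      simp [Module.algebraMap_end_apply, MulOpposite.algebraMap_apply, smul_mul_assoc,
        mul_smul_comm]

/-- The type of multipliers of `B`. -/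
abbrev Multiplier : Type u := multiplierAlgebra B

end Multipliers

namespace Multiplier

section Basic

variable {B : Type u} [NonUnitalRing B] [Module ℂ B] [IsScalarTower ℂ B B] [SMulCommClass ℂ B B]

/-- `x.left b = x b`. -/
def left (x : Multiplier B) : Module.End ℂ B := x.1.1

/-- `x.right b = b x`. -/
def right (x : Multiplier B) : Module.End ℂ B := x.1.2.unop

theorem ext' {x y : Multiplier B} (h : ∀ b, x.left b = y.left b)
    (k : ∀ b, x.right b = y.right b) : x = y := by
  apply Subtype.ext
  apply Prod.ext
  · exact LinearMap.ext h
  · exact MulOpposite.unop_injective (LinearMap.ext k)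

/-- Build a multiplier from its left and right parts. -/
def mk' (ψ ϕ : Module.End ℂ B) (h1 : ∀ a b, ψ (a * b) = ψ a * b)
    (h2 : ∀ a b, ϕ (a * b) = a * ϕ b) (h3 : ∀ a b, ϕ a * b = a * ψ b) : Multiplier B :=
  ⟨(ψ, MulOpposite.op ϕ), h1, h2, h3⟩

theorem left_mul' (x : Multiplier B) (a b : B) : x.left (a * b) = x.left a * b := x.2.1 a b

theorem right_mul' (x : Multiplier B) (a b : B) : x.right (a * b) = a * x.right b := x.2.2.1 a b

theorem central (x : Multiplier B) (a b : B) : x.right a * b = a * x.left b := x.2.2.2 a b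

/-- The canonical map `B → M(B)`, `b ↦ (left multiplication by b, right multiplication by b)`. -/
def of (b : B) : Multiplier B :=
  mk' (LinearMap.mulLeft ℂ b) (LinearMap.mulRight ℂ b)
    (fun a c => by simp [mul_assoc]) (fun a c => by simp [mul_assoc])
    (fun a c => by simp [mul_assoc])

end Basic

section Star

variable {B : Type u} [NonUnitalRing B] [Module ℂ B] [IsScalarTower ℂ B B] [SMulCommClass ℂ B B]
  [StarRing B] [StarModule ℂ B]

/-- For a linear map `ψ`, the linear map `ψ*(b) = ψ(b*)*`. -/
def starMap (ψ : Module.End ℂ B) : Module.End ℂ B where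
  toFun b := star (ψ (star b))
  map_add' a b := by simp
  map_smul' r b := by simp

/-- The involution `(ψ, ϕ)* = (ϕ*, ψ*)` of `M(B)`. -/
instance instStar : Star (Multiplier B) where
  star x := mk' (starMap x.right) (starMap x.left)
    (fun a b => by simp [starMap, right_mul'])
    (fun a b => by simp [starMap, left_mul'])
    (fun a b => by
      apply star_injective
      simp [starMap, central])

theorem star_left (x : Multiplier B) (b : B) : (star x).left b = star (x.right (star b)) := rfl

theorem star_right (x : Multiplier B) (b : B) : (star x).right b = star (x.left (star b)) := rfl

instance instStarRing : StarRing (Multiplier B) where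
  star_involutive x := by
    refine ext' (fun b => ?_) (fun b => ?_) <;> simp [star_left, star_right]
  star_mul x y := by
    refine ext' (fun b => ?_) (fun b => ?_)
    · change star (y.right (x.right (star b))) = star (y.right (star (star (x.right (star b)))))
      simp
    · change star (x.left (y.left (star b))) = star (x.left (star (star (y.left (star b)))))
      simp
  star_add x y := by
    refine ext' (fun b => ?_) (fun b => ?_)
    · change star (x.right (star b) + y.right (star b)) = _
      rw [star_add]; rfl
    · change star (x.left (star b) + y.left (star b)) = _
      rw [star_add]; rfl

end Star

section Tensor

variable {A : Type u} [NonUnitalRing A] [Module ℂ A] [IsScalarTower ℂ A A] [SMulCommClass ℂ A A]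

/-- The multiplier `x ⊗ y` of `A ⊗ A`. -/
noncomputable def tensor (x y : Multiplier A) : Multiplier (A ⊗[ℂ] A) :=
  mk' (TensorProduct.map x.left y.left) (TensorProduct.map x.right y.right)
    (fun a b => by
      induction a with
      | zero => simp
      | add a₁ a₂ h₁ h₂ => simp only [add_mul, map_add, h₁, h₂]
      | tmul a a' =>
        induction b with
        | zero => simp
        | add b₁ b₂ h₁ h₂ => simp only [mul_add, map_add, h₁, h₂]
        | tmul b b' => simp [Algebra.TensorProduct.tmul_mul_tmul, left_mul'])
    (fun a b => by
      induction a with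
      | zero => simp
      | add a₁ a₂ h₁ h₂ => simp only [add_mul, map_add, h₁, h₂]
      | tmul a a' =>
        induction b with
        | zero => simp
        | add b₁ b₂ h₁ h₂ => simp only [mul_add, map_add, h₁, h₂]
        | tmul b b' => simp [Algebra.TensorProduct.tmul_mul_tmul, right_mul'])
    (fun a b => by
      induction a with
      | zero => simp
      | add a₁ a₂ h₁ h₂ => simp only [add_mul, map_add, h₁, h₂]
      | tmul a a' =>
        induction b with
        | zero => simp
        | add b₁ b₂ h₁ h₂ => simp only [mul_add, map_add, h₁, h₂]
        | tmul b b' => simp [Algebra.TensorProduct.tmul_mul_tmul, central])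

theorem tensor_mul (x y x' y' : Multiplier A) :
    tensor x y * tensor x' y' = tensor (x * x') (y * y') := by
  refine ext' (fun b => ?_) (fun b => ?_)
  · change TensorProduct.map x.left y.left (TensorProduct.map x'.left y'.left b) =
      TensorProduct.map (x.left ∘ₗ x'.left) (y.left ∘ₗ y'.left) b
    rw [TensorProduct.map_comp]; rfl
  · change TensorProduct.map x'.right y'.right (TensorProduct.map x.right y.right b) =
      TensorProduct.map (x'.right ∘ₗ x.right) (y'.right ∘ₗ y.right) b
    rw [TensorProduct.map_comp]; rfl

theorem tensor_one : tensor (1 : Multiplier A) 1 = 1 := by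
  refine ext' (fun b => ?_) (fun b => ?_)
  · change TensorProduct.map LinearMap.id LinearMap.id b = b
    simp
  · change TensorProduct.map LinearMap.id LinearMap.id b = b
    simp

end Tensor

end Multiplier

section AQG

variable (A : Type u) [NonUnitalRing A] [Module ℂ A] [IsScalarTower ℂ A A] [SMulCommClass ℂ A A]
  [StarRing A] [StarModule ℂ A]

/-- An algebraic quantum group with underlying `*`-algebra `A`: a multiplier Hopf `*`-algebra
together with a non-zero positive left invariant functional `φ`.  The maps `T₁`, `T₂` are
determined by the comultiplication `Δ`; that they exist and are bijective is the axiom. -/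
structure AlgebraicQuantumGroup where
  /-- `A` is a non-degenerate algebra. -/
  eq_zero_of_mul_right : ∀ a : A, (∀ b, a * b = 0) → a = 0
  eq_zero_of_mul_left : ∀ a : A, (∀ b, b * a = 0) → a = 0
  /-- The comultiplication, a `*`-homomorphism `A → M(A ⊗ A)`. -/
  Δ : A →⋆ₙₐ[ℂ] Multiplier (A ⊗[ℂ] A)
  /-- `Δ` is non-degenerate: `Δ(A)(A ⊗ A) = A ⊗ A = (A ⊗ A)Δ(A)`. -/
  span_left : Submodule.span ℂ {z | ∃ a y, z = (Δ a).left y} = ⊤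
  span_right : Submodule.span ℂ {z | ∃ a y, z = (Δ a).right y} = ⊤
  /-- `T₁(a ⊗ b) = Δ(a)(1 ⊗ b)` is a bijection of `A ⊗ A`. -/
  T₁ : (A ⊗[ℂ] A) ≃ₗ[ℂ] (A ⊗[ℂ] A)
  of_T₁ : ∀ a b, Multiplier.of (T₁ (a ⊗ₜ b)) = Δ a * Multiplier.tensor 1 (Multiplier.of b)
  /-- `T₂(a ⊗ b) = (a ⊗ 1)Δ(b)` is a bijection of `A ⊗ A`. -/
  T₂ : (A ⊗[ℂ] A) ≃ₗ[ℂ] (A ⊗[ℂ] A)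
  of_T₂ : ∀ a b, Multiplier.of (T₂ (a ⊗ₜ b)) = Multiplier.tensor (Multiplier.of a) 1 * Δ b
  /-- Coassociativity:
  `(ι ⊗ Δ)((a ⊗ 1)Δ(b))(1 ⊗ 1 ⊗ c) = (a ⊗ 1 ⊗ 1)(Δ ⊗ ι)(Δ(b)(1 ⊗ c))`,
  that is, `(ι ⊗ T₁)(T₂ ⊗ ι) = (T₂ ⊗ ι)(ι ⊗ T₁)` on `A ⊗ A ⊗ A`. -/
  coassoc : ∀ a b c : A,
    (T₁ : A ⊗[ℂ] A →ₗ[ℂ] A ⊗[ℂ] A).lTensor A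
        (TensorProduct.assoc ℂ A A A (T₂ (a ⊗ₜ b) ⊗ₜ c)) =
      TensorProduct.assoc ℂ A A A ((T₂ : A ⊗[ℂ] A →ₗ[ℂ] A ⊗[ℂ] A).rTensor A
        ((TensorProduct.assoc ℂ A A A).symm (a ⊗ₜ T₁ (b ⊗ₜ c))))
  /-- The left invariant functional. -/
  φ : A →ₗ[ℂ] ℂ
  φ_ne_zero : φ ≠ 0
  φ_pos : ∀ a, 0 ≤ (φ (star a * a)).re ∧ (φ (star a * a)).im = 0
  /-- `(ι ⊗ φ)Δ(a) = φ(a)1`, tested as `(ι ⊗ φ)((b ⊗ 1)Δ(a)) = φ(a)b`. -/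
  φ_left_invariant : ∀ a b, TensorProduct.rid ℂ A (φ.lTensor A (T₂ (b ⊗ₜ a))) = φ a • b

end AQG

namespace AlgebraicQuantumGroup

variable {A : Type u} [NonUnitalRing A] [Module ℂ A] [IsScalarTower ℂ A A] [SMulCommClass ℂ A A]
  [StarRing A] [StarModule ℂ A] (Q : AlgebraicQuantumGroup A)

/-- `ε` is the counit: `(ε ⊗ ι)(Δ(a)(1 ⊗ b)) = ab` and `(ι ⊗ ε)((a ⊗ 1)Δ(b)) = ab`. -/
def IsCounit (ε : A →ₙₐ[ℂ] ℂ) : Prop :=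
  (∀ a b, TensorProduct.lid ℂ A ((ε : A →ₗ[ℂ] ℂ).rTensor A (Q.T₁ (a ⊗ₜ b))) = a * b) ∧
  ∀ a b, TensorProduct.rid ℂ A ((ε : A →ₗ[ℂ] ℂ).lTensor A (Q.T₂ (a ⊗ₜ b))) = a * b

/-- The algebraic quantum group is discrete: there is a non-zero left integral `h ∈ A`, that is,
`ah = ε(a)h` for all `a`. -/
def IsDiscrete : Prop :=
  ∃ ε : A →ₙₐ[ℂ] ℂ, Q.IsCounit ε ∧ ∃ h : A, h ≠ 0 ∧ ∀ a, a * h = ε a • h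

/-- `Δ x = X` for a multiplier `x` of `A`, where `Δ : M(A) → M(A ⊗ A)` is the unique extension of
the comultiplication, which is given by `Δ(x)Δ(a) = Δ(xa)` and `Δ(a)Δ(x) = Δ(ax)`. -/
def ComulEq (x : Multiplier A) (X : Multiplier (A ⊗[ℂ] A)) : Prop :=
  ∀ a, X * Q.Δ a = Q.Δ (x.left a) ∧ Q.Δ a * X = Q.Δ (x.right a)

theorem comulEq_unique {x : Multiplier A} {X Y : Multiplier (A ⊗[ℂ] A)} (hX : Q.ComulEq x X)
    (hY : Q.ComulEq x Y) : X = Y := by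
  refine Multiplier.ext' (fun b => ?_) (fun b => ?_)
  · have hb : b ∈ Submodule.span ℂ {z | ∃ a y, z = (Q.Δ a).left y} := by simp [Q.span_left]
    induction hb using Submodule.span_induction with
    | mem z hz =>
      obtain ⟨a, y, rfl⟩ := hz
      exact congrArg (fun Z : Multiplier (A ⊗[ℂ] A) => Z.left y) ((hX a).1.trans (hY a).1.symm)
    | zero => simp
    | add y z _ _ hy hz => simp [hy, hz]
    | smul r y _ hy => simp [hy]
  · have hb : b ∈ Submodule.span ℂ {z | ∃ a y, z = (Q.Δ a).right y} := by simp [Q.span_right]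
    induction hb using Submodule.span_induction with
    | mem z hz =>
      obtain ⟨a, y, rfl⟩ := hz
      exact congrArg (fun Z : Multiplier (A ⊗[ℂ] A) => Z.right y) ((hX a).2.trans (hY a).2.symm)
    | zero => simp
    | add y z _ _ hy hz => simp [hy, hz]
    | smul r y _ hy => simp [hy]

theorem comulEq_one : Q.ComulEq 1 1 := fun a => ⟨one_mul _, mul_one _⟩

theorem ComulEq.mul {Q : AlgebraicQuantumGroup A} {x y : Multiplier A}
    {X Y : Multiplier (A ⊗[ℂ] A)} (hX : Q.ComulEq x X) (hY : Q.ComulEq y Y) :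
    Q.ComulEq (x * y) (X * Y) := fun a => by
  constructor
  · rw [mul_assoc, (hY a).1, (hX _).1]; rfl
  · rw [← mul_assoc, (hX a).2, (hY _).2]; rfl

theorem ComulEq.inv {Q : AlgebraicQuantumGroup A} {x y : Multiplier A}
    {X Y : Multiplier (A ⊗[ℂ] A)} (hX : Q.ComulEq x X) (hxy : x * y = 1) (hyx : y * x = 1)
    (hXY : X * Y = 1) (hYX : Y * X = 1) : Q.ComulEq y Y := by
  intro a
  constructor
  · have h : x.left (y.left a) = a := congrArg (fun z : Multiplier A => z.left a) hxy
    have := (hX (y.left a)).1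
    rw [h] at this
    rw [← this, ← mul_assoc, hYX, one_mul]
  · have h : x.right (y.right a) = a := congrArg (fun z : Multiplier A => z.right a) hyx
    have := (hX (y.right a)).2
    rw [h] at this
    rw [← this, mul_assoc, hXY, mul_one]

/-- The intrinsic group `G = {g ∈ M(A) | Δg = g ⊗ g, g*g = gg* = 1}`. -/
noncomputable def intrinsicGroup : Subgroup (unitary (Multiplier A)) where
  carrier := {g | Q.ComulEq g (Multiplier.tensor (g : Multiplier A) g)}
  mul_mem' := by
    intro g h hg hh
    have := ComulEq.mul hg hh
    rw [Multiplier.tensor_mul] at this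
    exact this
  one_mem' := by
    have := Q.comulEq_one
    rw [← Multiplier.tensor_one] at this
    exact this
  inv_mem' := by
    intro g hg
    have h1 : (g : Multiplier A) * ((g⁻¹ : unitary (Multiplier A)) : Multiplier A) = 1 :=
      congrArg Subtype.val (mul_inv_cancel g)
    have h2 : ((g⁻¹ : unitary (Multiplier A)) : Multiplier A) * (g : Multiplier A) = 1 :=
      congrArg Subtype.val (inv_mul_cancel g)
    refine ComulEq.inv hg h1 h2 ?_ ?_
    · rw [Multiplier.tensor_mul, h1, Multiplier.tensor_one]
    · rw [Multiplier.tensor_mul, h2, Multiplier.tensor_one]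

/-- The Fourier transform `a ↦ â = φ(· a)`, with range the dual `Â`. -/
def fourier : A →ₗ[ℂ] (A →ₗ[ℂ] ℂ) :=
  LinearMap.mk₂ ℂ (fun a c => Q.φ (c * a))
    (by intros; simp [mul_add]) (by intros; simp [mul_smul_comm])
    (by intros; simp [add_mul]) (by intros; simp [smul_mul_assoc])

/-- The multiplication of the dual in terms of the Fourier transform: the linear map with
`a ⊗ b ↦ m̂(â ⊗ b̂) = (â ⊗ b̂)Δ = (φ ⊗ φ)(Δ(·)(a ⊗ b))`. -/
noncomputable def dualMul : (A ⊗[ℂ] A) →ₗ[ℂ] (A →ₗ[ℂ] ℂ) :=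
  LinearMap.mk₂ ℂ
    (fun x c => LinearMap.mul' ℂ ℂ (TensorProduct.map Q.φ Q.φ ((Q.Δ c).left x)))
    (by intros; simp) (by intros; simp)
    (by
      intro x c d
      have h : (Q.Δ (c + d)).left x = (Q.Δ c).left x + (Q.Δ d).left x := by rw [map_add]; rfl
      rw [h, map_add, map_add])
    (by
      intro r x c
      have h : (Q.Δ (r • c)).left x = r • (Q.Δ c).left x := by rw [map_smul]; rfl
      rw [h, map_smul, map_smul])

/-- `(m, η)` is the regular monoid structure `m̃ = F⁻¹ m̂ (F ⊗ F)`, `η̃(c) = c F⁻¹(1)` on `π_l`, where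
`F` is the Fourier transform and `m̂` the multiplication of the dual, whose unit is the counit. -/
def IsRegularMonoid (m : (A ⊗[ℂ] A) →ₗ[ℂ] A) (η : ℂ →ₗ[ℂ] A) : Prop :=
  Q.fourier ∘ₗ m = Q.dualMul ∧
    ∃ ε : A →ₙₐ[ℂ] ℂ, Q.IsCounit ε ∧ ∀ c a, Q.fourier (η c) a = c * ε a

end AlgebraicQuantumGroup

section RegularEnd

variable (A : Type u) [NonUnitalRing A] [Module ℂ A] [IsScalarTower ℂ A A] [SMulCommClass ℂ A A]

/-- `Hom(π_l, π_l)`: the linear maps intertwining the left regular representation with itself,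
with composition as multiplication. -/
def regularEnd : Subalgebra ℂ (Module.End ℂ A) where
  carrier := {s | ∀ a x, s (a * x) = a * s x}
  mul_mem' := by intro s t hs ht a x; simp [hs a, ht a]
  add_mem' := by intro s t hs ht a x; simp [hs a, ht a, mul_add]
  algebraMap_mem' := by intro r a x; simp [Module.algebraMap_end_apply, mul_smul_comm]

end RegularEnd

namespace AlgebraicQuantumGroup

variable {A : Type u} [NonUnitalRing A] [Module ℂ A] [IsScalarTower ℂ A A] [SMulCommClass ℂ A A]
  [StarRing A] [StarModule ℂ A] (Q : AlgebraicQuantumGroup A)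

/-- `t = s*`, that is, `(su, v) = (u, tv)` for the inner product `(x, y) = φ(y*x)` on `A`. -/
def IsAdjoint (s t : Module.End ℂ A) : Prop :=
  ∀ u v : A, Q.φ (star v * s u) = Q.φ (star (t v) * u)

/-- The intrinsic group of a multiplication `m` on the left regular representation:
`{t ∈ Hom(π_l, π_l) | t ∘ t* = t* ∘ t = id, m ∘ (t ⊗ t) = t ∘ m}`, with composition. -/
def regularIntrinsicGroup (m : (A ⊗[ℂ] A) →ₗ[ℂ] A) : Subgroup (regularEnd A)ˣ where
  carrier := {t | Q.IsAdjoint ((t : regularEnd A) : Module.End ℂ A)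
      ((t⁻¹ : (regularEnd A)ˣ) : regularEnd A) ∧
    m ∘ₗ TensorProduct.map ((t : regularEnd A) : Module.End ℂ A) ((t : regularEnd A) : Module.End ℂ A)
      = ((t : regularEnd A) : Module.End ℂ A) ∘ₗ m}
  mul_mem' := by
    rintro s t ⟨hs, hs'⟩ ⟨ht, ht'⟩
    constructor
    · intro u v
      have h1 := hs (((t : regularEnd A) : Module.End ℂ A) u) v
      have h2 := ht u ((((s⁻¹ : (regularEnd A)ˣ) : regularEnd A) : Module.End ℂ A) v)
      rw [mul_inv_rev]
      exact h1.trans h2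
    · change m ∘ₗ TensorProduct.map (((s : regularEnd A) : Module.End ℂ A) ∘ₗ
          ((t : regularEnd A) : Module.End ℂ A)) (((s : regularEnd A) : Module.End ℂ A) ∘ₗ
          ((t : regularEnd A) : Module.End ℂ A)) = (((s : regularEnd A) : Module.End ℂ A) ∘ₗ
          ((t : regularEnd A) : Module.End ℂ A)) ∘ₗ m
      rw [TensorProduct.map_comp, ← LinearMap.comp_assoc, hs', LinearMap.comp_assoc, ht',
        LinearMap.comp_assoc]
  one_mem' := by
    constructor
    · intro u v
      rw [inv_one]; rfl
    · change m ∘ₗ TensorProduct.map LinearMap.id LinearMap.id = LinearMap.id ∘ₗ m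
      simp
  inv_mem' := by
    rintro t ⟨ht, ht'⟩
    have e1 : ∀ x, ((t : regularEnd A) : Module.End ℂ A)
        ((((t⁻¹ : (regularEnd A)ˣ) : regularEnd A) : Module.End ℂ A) x) = x := fun x =>
      congrArg (fun s : regularEnd A => (s : Module.End ℂ A) x) t.mul_inv
    have e2 : ∀ x, (((t⁻¹ : (regularEnd A)ˣ) : regularEnd A) : Module.End ℂ A)
        (((t : regularEnd A) : Module.End ℂ A) x) = x := fun x =>
      congrArg (fun s : regularEnd A => (s : Module.End ℂ A) x) t.inv_mul
    constructor
    · intro u v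
      have h := ht ((((t⁻¹ : (regularEnd A)ˣ) : regularEnd A) : Module.End ℂ A) u)
        (((t : regularEnd A) : Module.End ℂ A) v)
      rw [e1, e2] at h
      rw [inv_inv]
      exact h.symm
    · ext x y
      have h := LinearMap.congr_fun ht'
        ((((t⁻¹ : (regularEnd A)ˣ) : regularEnd A) : Module.End ℂ A) x ⊗ₜ[ℂ]
          (((t⁻¹ : (regularEnd A)ˣ) : regularEnd A) : Module.End ℂ A) y)
      simp only [LinearMap.comp_apply, TensorProduct.map_tmul, e1] at h
      simp only [TensorProduct.AlgebraTensorModule.curry_apply, TensorProduct.curry_apply,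
        LinearMap.coe_restrictScalars, LinearMap.comp_apply, TensorProduct.map_tmul, h, e2]

end AlgebraicQuantumGroup

section Blocks

variable (A : Type u) [NonUnitalRing A] [Module ℂ A] [StarRing A]

/-- A `*`-isomorphism `A ≅ ⨁ᵢ End Hᵢ` with `Hᵢ = ℂ^{nᵢ}` non-zero finite dimensional Hilbert spaces,
given by the projections `pᵢ : A → End Hᵢ`. -/
structure BlockDecomposition where
  /-- The index set. -/
  ι : Type u
  /-- `nᵢ = dim Hᵢ`. -/
  n : ι → ℕ
  n_pos : ∀ i, 0 < n i
  /-- The projection `A → End Hᵢ`. -/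
  p : ∀ i, A →⋆ₙₐ[ℂ] Matrix (Fin (n i)) (Fin (n i)) ℂ
  finite_support : ∀ a, {i | p i a ≠ 0}.Finite
  existsUnique : ∀ x : (∀ i, Matrix (Fin (n i)) (Fin (n i)) ℂ), {i | x i ≠ 0}.Finite →
    ∃! a, ∀ i, p i a = x i

end Blocks

namespace BlockDecomposition

variable {A : Type u} [NonUnitalRing A] [Module ℂ A] [IsScalarTower ℂ A A] [SMulCommClass ℂ A A]
  [StarRing A] [StarModule ℂ A] (D : BlockDecomposition A)

open Classical in
theorem exists_single (i : D.ι) (y : Matrix (Fin (D.n i)) (Fin (D.n i)) ℂ) :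
    ∃ a, ∀ j, D.p j a = (Pi.single i y : ∀ j, Matrix (Fin (D.n j)) (Fin (D.n j)) ℂ) j := by
  refine (D.existsUnique _ ((Set.finite_singleton i).subset fun j hj => ?_)).exists
  by_contra h
  exact hj (Pi.single_eq_of_ne (M := fun j => Matrix (Fin (D.n j)) (Fin (D.n j)) ℂ) h y)

/-- The inclusion `End Hᵢ → A`. -/
noncomputable def single (i : D.ι) (y : Matrix (Fin (D.n i)) (Fin (D.n i)) ℂ) : A :=
  (D.exists_single i y).choose

/-- The map `M(A) → ∏ᵢ End Hᵢ`, `x ↦ (x Iᵢ)ᵢ`, where `Iᵢ` is the unit of `End Hᵢ`. -/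
noncomputable def multiplierComponents (x : Multiplier A) (i : D.ι) :
    Matrix (Fin (D.n i)) (Fin (D.n i)) ℂ :=
  D.p i (x.left (D.single i 1))

/-- The restrictions of `s ∈ Hom(π_l, π_l)` to the isotypic components `End Hᵢ` of `π_l`. -/
noncomputable def regularEndComponents (s : regularEnd A) (i : D.ι)
    (y : Matrix (Fin (D.n i)) (Fin (D.n i)) ℂ) : Matrix (Fin (D.n i)) (Fin (D.n i)) ℂ :=
  D.p i ((s : Module.End ℂ A) (D.single i y))

/-- The product topology on `M(A) = ∏ᵢ End Hᵢ`. -/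
@[reducible] noncomputable def multiplierTopology : TopologicalSpace (Multiplier A) :=
  TopologicalSpace.induced D.multiplierComponents inferInstance

/-- The product topology on `Hom(π_l, π_l) = ∏ᵢ Hom(nᵢpᵢ, nᵢpᵢ)`, where the finite dimensional
space `Hom(nᵢpᵢ, nᵢpᵢ)` of linear endomorphisms of `End Hᵢ` has its usual topology, which is that
of pointwise convergence. -/
@[reducible] noncomputable def regularEndTopology : TopologicalSpace (regularEnd A) :=
  TopologicalSpace.induced D.regularEndComponents inferInstance

/-- The topology on the intrinsic group of `Q` as a subset of `M(A)`. -/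
@[reducible] noncomputable def intrinsicGroupTopology (Q : AlgebraicQuantumGroup A) :
    TopologicalSpace Q.intrinsicGroup :=
  D.multiplierTopology.induced fun g => ((g : unitary (Multiplier A)) : Multiplier A)

/-- The topology on the intrinsic group of `(π_l, m)` as a subset of `Hom(π_l, π_l)`. -/
@[reducible] noncomputable def regularIntrinsicGroupTopology (Q : AlgebraicQuantumGroup A)
    (m : (A ⊗[ℂ] A) →ₗ[ℂ] A) : TopologicalSpace (Q.regularIntrinsicGroup m) :=
  D.regularEndTopology.induced fun t => ((t : (regularEnd A)ˣ) : regularEnd A)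

end BlockDecomposition

/-! The isomorphism sends `g` to right multiplication by `g⁻¹`. Since `M(A)` is the full product of
the matrix blocks, every endomorphism of `π_l` is right multiplication by some multiplier `r`.
Suppose that `φ(ar) = φ(ga)` for all `a`. Then `φ(c m(x(r ⊗ r))) = (φ ⊗ φ)((g ⊗ g)Δ(c)x)` and `φ(c
m(x)r) = (φ ⊗ φ)(Δ(gc)x)`. As `φ ⊗ φ` is faithful, `r` respects `m` exactly when `g` is group-like
(`IsRegularMonoid.comp_map_right_iff`). Unitarity of right multiplication by `r` says precisely that
`g = (r⁻¹)*` has this property (`isAdjoint_right_iff`). Finally `φ(ga) = φ(ag)` for invertible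
group-like `g` (`φ_grouplike_comm`), so faithfulness gives `r = g = (r⁻¹)*`, and `r` is a unitary in
`M(A)`.

The analytic input comes from the integral `h`: the slices of `Δ(h)` separate functionals
(`eq_zero_of_slice_integral`). This yields `φ(h) ≠ 0` and the faithfulness of `φ`. It also yields
the centrality above, because `gh = h = hg` makes `φ(g ·)` and `φ(· g)` agree on the slices of
`Δ(h)`. The same separation embeds each `Ax` in a finite dimensional space. A `*`-algebra with a
faithful positive functional and finite dimensional `Ax` is a direct sum of matrix algebras: minimal
left ideals are generated by minimal projections, and choosing one projection `p` per block lets `A`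
act on the Hilbert space `Ap`.

For the topology, `G` is closed in a product of unitary groups, hence compact. In components the
isomorphism is `g ↦ (y ↦ y gᵢ*)`, which is continuous with continuous inverse. -/

namespace TensorProduct

/-! ### Separating tensors by slices -/

section Separation

variable {V W U : Type*} [AddCommGroup V] [Module ℂ V] [AddCommGroup W] [Module ℂ W]
  [AddCommGroup U] [Module ℂ U]

theorem equivFinsuppOfBasisLeft_lTensor {ι : Type*} [DecidableEq ι] (b : Module.Basis ι ℂ V)
    (f : W →ₗ[ℂ] U) (z : V ⊗[ℂ] W) (i : ι) :
    TensorProduct.equivFinsuppOfBasisLeft b (f.lTensor V z) i =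
      f (TensorProduct.equivFinsuppOfBasisLeft b z i) := by
  induction z with
  | zero => simp
  | add x y hx hy => simp [hx, hy]
  | tmul v w => simp [TensorProduct.equivFinsuppOfBasisLeft_apply_tmul]

/-- If `z ∈ V ⊗ W` is killed by all `ι ⊗ f k`, then it lies in `V ⊗ ⋂ ker f k`, and so is killed by
`ι ⊗ g` for every `g` vanishing on `⋂ ker f k`. -/
theorem lTensor_eq_zero_of_forall {κ : Type*} {W' : κ → Type*} [∀ k, AddCommGroup (W' k)]
    [∀ k, Module ℂ (W' k)] (f : ∀ k, W →ₗ[ℂ] W' k) (g : W →ₗ[ℂ] U)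
    (hg : ∀ w, (∀ k, f k w = 0) → g w = 0) (z : V ⊗[ℂ] W)
    (hz : ∀ k, (f k).lTensor V z = 0) : g.lTensor V z = 0 := by
  classical
  apply (TensorProduct.equivFinsuppOfBasisLeft (Module.Basis.ofVectorSpace ℂ V)).injective
  ext i
  rw [equivFinsuppOfBasisLeft_lTensor, map_zero, Finsupp.zero_apply]
  refine hg _ fun k => ?_
  rw [← equivFinsuppOfBasisLeft_lTensor, hz k, map_zero, Finsupp.zero_apply]

theorem eq_zero_of_forall_lTensor {κ : Type*} {W' : κ → Type*} [∀ k, AddCommGroup (W' k)]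
    [∀ k, Module ℂ (W' k)] (f : ∀ k, W →ₗ[ℂ] W' k) (hf : ∀ w, (∀ k, f k w = 0) → w = 0)
    (z : V ⊗[ℂ] W) (hz : ∀ k, (f k).lTensor V z = 0) : z = 0 := by
  simpa using lTensor_eq_zero_of_forall f LinearMap.id hf z hz

theorem eq_zero_of_forall_rTensor {κ : Type*} {W' : κ → Type*} [∀ k, AddCommGroup (W' k)]
    [∀ k, Module ℂ (W' k)] (f : ∀ k, W →ₗ[ℂ] W' k) (hf : ∀ w, (∀ k, f k w = 0) → w = 0)
    (z : W ⊗[ℂ] V) (hz : ∀ k, (f k).rTensor V z = 0) : z = 0 := by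
  apply (TensorProduct.comm ℂ W V).injective
  rw [map_zero]
  refine eq_zero_of_forall_lTensor f hf _ fun k => ?_
  rw [LinearMap.lTensor_comm, hz k, map_zero]

/-- `ι ⊗ θ` as a map to `V`. -/
noncomputable def slice (θ : W →ₗ[ℂ] ℂ) : V ⊗[ℂ] W →ₗ[ℂ] V :=
  (TensorProduct.rid ℂ V : V ⊗[ℂ] ℂ →ₗ[ℂ] V) ∘ₗ θ.lTensor V

@[simp] theorem slice_tmul (θ : W →ₗ[ℂ] ℂ) (v : V) (w : W) : slice θ (v ⊗ₜ w) = θ w • v := by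
  simp [slice]

theorem slice_lTensor (θ : U →ₗ[ℂ] ℂ) (f : W →ₗ[ℂ] U) (z : V ⊗[ℂ] W) :
    slice θ (f.lTensor V z) = slice (θ ∘ₗ f) z := by
  induction z with
  | zero => simp
  | add x y hx hy => simp [hx, hy]
  | tmul v w => simp

theorem slice_rTensor (θ : W →ₗ[ℂ] ℂ) (f : V →ₗ[ℂ] U) (z : V ⊗[ℂ] W) :
    slice θ (f.rTensor W z) = f (slice θ z) := by
  induction z with
  | zero => simp
  | add x y hx hy => simp [hx, hy]
  | tmul v w => simp

theorem lTensor_eq_zero_of_slice {θ : W →ₗ[ℂ] ℂ} {z : V ⊗[ℂ] W} (h : slice θ z = 0) :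
    θ.lTensor V z = 0 := by
  simpa [slice] using h

/-- The slices of a tensor lie in a finite dimensional subspace. -/
theorem exists_finiteDimensional_slice (z : V ⊗[ℂ] W) :
    ∃ F : Submodule ℂ V, FiniteDimensional ℂ F ∧ ∀ θ : W →ₗ[ℂ] ℂ, slice θ z ∈ F := by
  induction z with
  | zero => exact ⟨⊥, inferInstance, fun θ => by simp⟩
  | add x y hx hy =>
    obtain ⟨F, _, hF⟩ := hx
    obtain ⟨F', _, hF'⟩ := hy
    exact ⟨F ⊔ F', inferInstance, fun θ => by
      rw [map_add]
      exact add_mem (Submodule.mem_sup_left (hF θ)) (Submodule.mem_sup_right (hF' θ))⟩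
  | tmul v w =>
    exact ⟨ℂ ∙ v, inferInstance, fun θ => by
      rw [slice_tmul]
      exact Submodule.smul_mem _ _ (Submodule.mem_span_singleton_self v)⟩

end Separation

end TensorProduct

open TensorProduct LinearMap

/-! ### Multipliers of `A ⊗ A` and the four canonical maps -/

namespace Multiplier

section

variable {B : Type u} [NonUnitalRing B] [Module ℂ B] [IsScalarTower ℂ B B] [SMulCommClass ℂ B B]

@[simp] theorem mul_left (x y : Multiplier B) (b : B) : (x * y).left b = x.left (y.left b) := rfl

@[simp] theorem one_left (b : B) : (1 : Multiplier B).left b = b := rfl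

@[simp] theorem mul_right (x y : Multiplier B) (b : B) : (x * y).right b = y.right (x.right b) :=
  rfl

end

end Multiplier

section

variable {A : Type u} [NonUnitalRing A] [Module ℂ A] [IsScalarTower ℂ A A] [SMulCommClass ℂ A A]

theorem Multiplier.tensor_left (x y : Multiplier A) :
    (Multiplier.tensor x y).left = TensorProduct.map x.left y.left := rfl

theorem Multiplier.tensor_right (x y : Multiplier A) :
    (Multiplier.tensor x y).right = TensorProduct.map x.right y.right := rfl

theorem rTensor_mulLeft_mul (a : A) (v w : A ⊗[ℂ] A) :
    (mulLeft ℂ a).rTensor A v * w = (mulLeft ℂ a).rTensor A (v * w) := by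
  induction v with
  | zero => simp
  | add x y hx hy => simp [add_mul, hx, hy]
  | tmul v v' =>
    induction w with
    | zero => simp
    | add x y hx hy => simp_all [mul_add]
    | tmul w w' => simp [mul_assoc]

theorem lTensor_mulLeft_mul (a : A) (v w : A ⊗[ℂ] A) :
    (mulLeft ℂ a).lTensor A v * w = (mulLeft ℂ a).lTensor A (v * w) := by
  induction v with
  | zero => simp
  | add x y hx hy => simp [add_mul, hx, hy]
  | tmul v v' =>
    induction w with
    | zero => simp
    | add x y hx hy => simp_all [mul_add]
    | tmul w w' => simp [mul_assoc]

theorem rTensor_mulRight_mul (a : A) (v w : A ⊗[ℂ] A) :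
    (mulRight ℂ a).rTensor A v * w = v * (mulLeft ℂ a).rTensor A w := by
  induction v with
  | zero => simp
  | add x y hx hy => simp [add_mul, hx, hy]
  | tmul v v' =>
    induction w with
    | zero => simp
    | add x y hx hy => simp_all [mul_add]
    | tmul w w' => simp [mul_assoc]

theorem lTensor_mulRight_mul (a : A) (v w : A ⊗[ℂ] A) :
    (mulRight ℂ a).lTensor A v * w = v * (mulLeft ℂ a).lTensor A w := by
  induction v with
  | zero => simp
  | add x y hx hy => simp [add_mul, hx, hy]
  | tmul v v' =>
    induction w with
    | zero => simp
    | add x y hx hy => simp_all [mul_add]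
    | tmul w w' => simp [mul_assoc]

variable [StarRing A] [StarModule ℂ A]

theorem star_rTensor_mulRight (a : A) (w : A ⊗[ℂ] A) :
    star ((mulRight ℂ (star a)).rTensor A (star w)) = (mulLeft ℂ a).rTensor A w := by
  induction w with
  | zero => simp
  | add x y hx hy => simp [hx, hy]
  | tmul w w' => simp

theorem star_lTensor_mulRight (a : A) (w : A ⊗[ℂ] A) :
    star ((mulRight ℂ (star a)).lTensor A w) = (mulLeft ℂ a).lTensor A (star w) := by
  induction w with
  | zero => simp
  | add x y hx hy => simp [hx, hy]
  | tmul w w' => simp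

end

namespace AlgebraicQuantumGroup

variable {A : Type u} [NonUnitalRing A] [Module ℂ A] [IsScalarTower ℂ A A] [SMulCommClass ℂ A A]
  [StarRing A] [StarModule ℂ A] (Q : AlgebraicQuantumGroup A)

include Q in
theorem tensor_eq_zero (w : A ⊗[ℂ] A) (h : ∀ v, w * v = 0) : w = 0 := by
  refine eq_zero_of_forall_lTensor (fun b : A => mulRight ℂ b) Q.eq_zero_of_mul_right w fun b => ?_
  refine eq_zero_of_forall_rTensor (fun a : A => mulRight ℂ a) Q.eq_zero_of_mul_right _ fun a => ?_
  rw [← h (a ⊗ₜ b)]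
  clear h
  induction w with
  | zero => simp
  | add x y hx hy => simp [add_mul, hx, hy]
  | tmul w w' => simp

include Q in
theorem tensor_ext {v w : A ⊗[ℂ] A} (h : ∀ u, v * u = w * u) : v = w :=
  sub_eq_zero.1 <| Q.tensor_eq_zero _ fun u => by rw [sub_mul, h, sub_self]

include Q in
theorem ext_mul_right {a b : A} (h : ∀ c, a * c = b * c) : a = b :=
  sub_eq_zero.1 <| Q.eq_zero_of_mul_right _ fun u => by rw [sub_mul, h, sub_self]

include Q in
theorem ext_mul_left {a b : A} (h : ∀ c, c * a = c * b) : a = b :=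
  sub_eq_zero.1 <| Q.eq_zero_of_mul_left _ fun u => by rw [mul_sub, h, sub_self]

theorem T₁_mul (a b : A) (w : A ⊗[ℂ] A) :
    Q.T₁ (a ⊗ₜ b) * w = (Q.Δ a).left ((mulLeft ℂ b).lTensor A w) :=
  congrArg (fun X : Multiplier (A ⊗[ℂ] A) => X.left w) (Q.of_T₁ a b)

theorem T₂_mul (a b : A) (w : A ⊗[ℂ] A) :
    Q.T₂ (a ⊗ₜ b) * w = (mulLeft ℂ a).rTensor A ((Q.Δ b).left w) :=
  congrArg (fun X : Multiplier (A ⊗[ℂ] A) => X.left w) (Q.of_T₂ a b)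

theorem mul_T₁ (a b : A) (w : A ⊗[ℂ] A) :
    w * Q.T₁ (a ⊗ₜ b) = (mulRight ℂ b).lTensor A ((Q.Δ a).right w) :=
  congrArg (fun X : Multiplier (A ⊗[ℂ] A) => X.right w) (Q.of_T₁ a b)

theorem mul_T₂ (a b : A) (w : A ⊗[ℂ] A) :
    w * Q.T₂ (a ⊗ₜ b) = (Q.Δ b).right ((mulRight ℂ a).rTensor A w) :=
  congrArg (fun X : Multiplier (A ⊗[ℂ] A) => X.right w) (Q.of_T₂ a b)

theorem Δ_star_right (a : A) (w : A ⊗[ℂ] A) :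
    (Q.Δ (star a)).right w = star ((Q.Δ a).left (star w)) := by
  rw [map_star, Multiplier.star_right]

/-- `T₁'(a ⊗ b) = (1 ⊗ b)Δ(a)`. -/
noncomputable def T₁' : (A ⊗[ℂ] A) →ₗ[ℂ] (A ⊗[ℂ] A) where
  toFun z := star (Q.T₁ (star z))
  map_add' := by simp
  map_smul' := by simp

/-- `T₃(a ⊗ b) = Δ(a)(b ⊗ 1)`. -/
noncomputable def T₃ : (A ⊗[ℂ] A) ≃ₗ[ℂ] (A ⊗[ℂ] A) where
  toFun z := star (Q.T₂ (TensorProduct.comm ℂ A A (star z)))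
  map_add' := by simp
  map_smul' := by simp
  invFun z := star ((TensorProduct.comm ℂ A A).symm (Q.T₂.symm (star z)))
  left_inv z := by simp
  right_inv z := by simp

theorem T₁'_mul (a b : A) (w : A ⊗[ℂ] A) :
    Q.T₁' (a ⊗ₜ b) * w = (mulLeft ℂ b).lTensor A ((Q.Δ a).left w) := by
  change star (Q.T₁ (star (a ⊗ₜ[ℂ] b))) * w = _
  rw [← star_star w, ← star_mul, TensorProduct.star_tmul, mul_T₁, star_lTensor_mulRight,
    Δ_star_right, star_star]

theorem T₃_mul (a b : A) (w : A ⊗[ℂ] A) :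
    Q.T₃ (a ⊗ₜ b) * w = (Q.Δ a).left ((mulLeft ℂ b).rTensor A w) := by
  change star (Q.T₂ (TensorProduct.comm ℂ A A (star (a ⊗ₜ[ℂ] b)))) * w = _
  rw [← star_star w, ← star_mul, TensorProduct.star_tmul, TensorProduct.comm_tmul, mul_T₂,
    Δ_star_right, star_star, star_rTensor_mulRight, star_star]

/-- Two bracketings of `(1 ⊗ b)Δ(a)(1 ⊗ c)`. The next two lemmas do the same for `(c ⊗ b)Δ(a)` and
`(c ⊗ 1)Δ(a)(b ⊗ 1)`. -/
theorem T₁'_lTensor (a b c : A) :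
    (mulRight ℂ c).lTensor A (Q.T₁' (a ⊗ₜ b)) = (mulLeft ℂ b).lTensor A (Q.T₁ (a ⊗ₜ c)) :=
  Q.tensor_ext fun w => by
    rw [lTensor_mulRight_mul, lTensor_mulLeft_mul, T₁'_mul, T₁_mul]

theorem rTensor_T₁' (a b c : A) :
    (mulLeft ℂ c).rTensor A (Q.T₁' (a ⊗ₜ b)) = (mulLeft ℂ b).lTensor A (Q.T₂ (c ⊗ₜ a)) :=
  Q.tensor_ext fun w => by
    rw [rTensor_mulLeft_mul, lTensor_mulLeft_mul, T₁'_mul, T₂_mul]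
    exact LinearMap.congr_fun ((rTensor_comp_lTensor A _ _).trans
      (lTensor_comp_rTensor A _ _).symm) _

theorem rTensor_T₃ (a b c : A) :
    (mulLeft ℂ c).rTensor A (Q.T₃ (a ⊗ₜ b)) = (mulRight ℂ b).rTensor A (Q.T₂ (c ⊗ₜ a)) :=
  Q.tensor_ext fun w => by
    rw [rTensor_mulLeft_mul, rTensor_mulRight_mul, T₃_mul, T₂_mul]

/-- Bracketing as `(Δ(a)(b ⊗ 1))(1 ⊗ c)` trades the multiplier `Δ(a)` for an element of `A ⊗ A`,
which can be sliced. -/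
theorem Δ_left_tmul (a b c : A) :
    (Q.Δ a).left (b ⊗ₜ c) = (mulRight ℂ c).lTensor A (Q.T₃ (a ⊗ₜ b)) :=
  Q.tensor_ext fun w => by
    rw [lTensor_mulRight_mul, T₃_mul, ← Multiplier.left_mul']
    congr 1
    induction w with
    | zero => simp
    | add x y hx hy => simp [mul_add, hx, hy]
    | tmul w w' => simp

theorem Δ_right_tmul (a b c : A) :
    (Q.Δ a).right (b ⊗ₜ c) = (mulLeft ℂ c).lTensor A (Q.T₂ (b ⊗ₜ a)) :=
  Q.tensor_ext fun w => by
    rw [lTensor_mulLeft_mul, T₂_mul, Multiplier.central]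
    generalize (Q.Δ a).left w = w
    induction w with
    | zero => simp
    | add x y hx hy => simp [mul_add, hx, hy]
    | tmul w w' => simp

theorem Δ_mul_left (a b : A) (w : A ⊗[ℂ] A) :
    (Q.Δ (a * b)).left w = (Q.Δ a).left ((Q.Δ b).left w) := by
  rw [map_mul]; rfl

theorem Δ_left_T₃ (a b c : A) : (Q.Δ a).left (Q.T₃ (b ⊗ₜ c)) = Q.T₃ ((a * b) ⊗ₜ c) :=
  Q.tensor_ext fun w => by
    rw [← Multiplier.left_mul', T₃_mul, T₃_mul, Δ_mul_left]

theorem Δ_right_T₂ (a b c : A) : (Q.Δ a).right (Q.T₂ (b ⊗ₜ c)) = Q.T₂ (b ⊗ₜ (c * a)) :=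
  Q.tensor_ext fun w => by
    rw [Multiplier.central, T₂_mul, T₂_mul, Δ_mul_left]

theorem slice_φ_T₂ (a b : A) : slice Q.φ (Q.T₂ (b ⊗ₜ a)) = Q.φ a • b := Q.φ_left_invariant a b

/-- Left multiplication by `c ⊗ 1` turns `Δ(a)(b ⊗ 1)` into `(c ⊗ 1)Δ(a)(b ⊗ 1)`, where left
invariance in the form for `T₂` applies. -/
theorem slice_φ_T₃ (a b : A) : slice Q.φ (Q.T₃ (a ⊗ₜ b)) = Q.φ a • b :=
  Q.ext_mul_left fun c => by
    rw [← mulLeft_apply (R := ℂ), ← slice_rTensor, rTensor_T₃, slice_rTensor, slice_φ_T₂]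
    simp [mul_smul_comm]

end AlgebraicQuantumGroup

/-! ### Leg maps, the counit and left integrals -/

namespace AlgebraicQuantumGroup

variable {A : Type u} [NonUnitalRing A] [Module ℂ A] [IsScalarTower ℂ A A] [SMulCommClass ℂ A A]
  [StarRing A] [StarModule ℂ A] (Q : AlgebraicQuantumGroup A)

/-- `x ↦ (ι ⊗ θ)((1 ⊗ y)Δ(x))`. -/
noncomputable def legMap (θ : A →ₗ[ℂ] ℂ) (y : A) : A →ₗ[ℂ] A :=
  slice θ ∘ₗ Q.T₁' ∘ₗ (TensorProduct.mk ℂ A A).flip y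

theorem legMap_apply (θ : A →ₗ[ℂ] ℂ) (y x : A) : Q.legMap θ y x = slice θ (Q.T₁' (x ⊗ₜ y)) := rfl

theorem mul_legMap (θ : A →ₗ[ℂ] ℂ) (b y x : A) :
    b * Q.legMap θ y x = slice (θ ∘ₗ mulLeft ℂ y) (Q.T₂ (b ⊗ₜ x)) := by
  rw [legMap_apply, ← mulLeft_apply (R := ℂ), ← slice_rTensor, rTensor_T₁', slice_lTensor]

/-- Multiplying the third leg on the right by `z` replaces `(1 ⊗ c)Δ(·)` by `(1 ⊗ c)` times `Δ(·)(1
⊗ z)`, which reduces the claim to the axiom for `T₁`. Non-degeneracy then removes `z`. -/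
theorem coassoc_T₁' (a b c : A) :
    Q.T₁'.lTensor A (TensorProduct.assoc ℂ A A A (Q.T₂ (a ⊗ₜ b) ⊗ₜ c)) =
      TensorProduct.assoc ℂ A A A ((Q.T₂ : A ⊗[ℂ] A →ₗ[ℂ] A ⊗[ℂ] A).rTensor A
        ((TensorProduct.assoc ℂ A A A).symm (a ⊗ₜ Q.T₁' (b ⊗ₜ c)))) := by
  have key : ∀ (g : A →ₗ[ℂ] A) (v : A ⊗[ℂ] A),
      (g.lTensor A).lTensor A (TensorProduct.assoc ℂ A A A
        ((Q.T₂ : A ⊗[ℂ] A →ₗ[ℂ] A ⊗[ℂ] A).rTensor A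
          ((TensorProduct.assoc ℂ A A A).symm (a ⊗ₜ v)))) =
      TensorProduct.assoc ℂ A A A ((Q.T₂ : A ⊗[ℂ] A →ₗ[ℂ] A ⊗[ℂ] A).rTensor A
          ((TensorProduct.assoc ℂ A A A).symm (a ⊗ₜ g.lTensor A v))) := by
    intro g v
    induction v with
    | zero => simp
    | add x y hx hy => simp only [tmul_add, map_add, hx, hy]
    | tmul p q =>
      simp only [lTensor_tmul, TensorProduct.assoc_symm_tmul, rTensor_tmul, LinearEquiv.coe_coe]
      induction Q.T₂ (a ⊗ₜ p) with
      | zero => simp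
      | add x y hx hy => simp only [add_tmul, map_add, hx, hy]
      | tmul x y => simp
  rw [← sub_eq_zero]
  refine eq_zero_of_forall_lTensor (fun z : A => (mulRight ℂ z).lTensor A)
    (eq_zero_of_forall_lTensor (fun z : A => mulRight ℂ z) Q.eq_zero_of_mul_right) _ fun z => ?_
  rw [map_sub, sub_eq_zero, key, T₁'_lTensor, ← key, ← coassoc]
  induction Q.T₂ (a ⊗ₜ b) with
  | zero => simp
  | add x y hx hy => simp only [add_tmul, map_add, hx, hy]
  | tmul x y => simp [T₁'_lTensor]

/-- Coassociativity with `θ(y ·)` applied to the third leg: leg maps act on the right leg, so they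
pass through `(b ⊗ 1)Δ(·)`. -/
theorem legMap_T₂ (θ : A →ₗ[ℂ] ℂ) (y b x : A) :
    (Q.legMap θ y).lTensor A (Q.T₂ (b ⊗ₜ x)) = Q.T₂ (b ⊗ₜ Q.legMap θ y x) := by
  have key := congrArg ((slice θ : A ⊗[ℂ] A →ₗ[ℂ] A).lTensor A) (Q.coassoc_T₁' b x y)
  rw [legMap_apply]
  convert key using 1
  · induction Q.T₂ (b ⊗ₜ x) with
    | zero => simp
    | add x y hx hy => simp only [add_tmul, map_add, hx, hy]
    | tmul x y => simp [legMap_apply]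
  · induction Q.T₁' (x ⊗ₜ y) with
    | zero => simp
    | add x y hx hy => simp only [tmul_add, map_add, hx, hy]
    | tmul p q =>
      simp only [TensorProduct.assoc_symm_tmul, rTensor_tmul, LinearEquiv.coe_coe, slice_tmul,
        tmul_smul, map_smul]
      induction Q.T₂ (b ⊗ₜ p) with
      | zero => simp
      | add x y hx hy => simp only [add_tmul, map_add, smul_add, hx, hy]
      | tmul x y => simp [tmul_smul]

theorem legMap_T₂_symm (θ : A →ₗ[ℂ] ℂ) (y : A) (z : A ⊗[ℂ] A) :
    (Q.legMap θ y).lTensor A (Q.T₂.symm z) = Q.T₂.symm ((Q.legMap θ y).lTensor A z) := by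
  apply Q.T₂.injective
  rw [LinearEquiv.apply_symm_apply]
  obtain ⟨w, rfl⟩ := Q.T₂.surjective z
  rw [LinearEquiv.symm_apply_apply]
  induction w with
  | zero => simp
  | add x y hx hy => simp only [map_add, hx, hy]
  | tmul b x => rw [lTensor_tmul, legMap_T₂]

section Counit

variable {Q} {ε : A →ₙₐ[ℂ] ℂ}

theorem IsCounit.slice_T₂ (hε : Q.IsCounit ε) (a b : A) :
    slice (ε : A →ₗ[ℂ] ℂ) (Q.T₂ (a ⊗ₜ b)) = a * b := hε.2 a b

/-- As `T₂` is onto, this determines `ι ⊗ ε`; uniqueness of the counit and `A² = A` both follow. -/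
theorem IsCounit.slice_eq (hε : Q.IsCounit ε) (z : A ⊗[ℂ] A) :
    slice (ε : A →ₗ[ℂ] ℂ) z = mul' ℂ A (Q.T₂.symm z) := by
  obtain ⟨w, rfl⟩ := Q.T₂.surjective z
  rw [LinearEquiv.symm_apply_apply]
  induction w with
  | zero => simp
  | add x y hx hy => simp only [map_add, hx, hy]
  | tmul b x => rw [hε.slice_T₂, mul'_apply]

theorem IsCounit.lid_T₁' (hε : Q.IsCounit ε) (x y : A) :
    TensorProduct.lid ℂ A ((ε : A →ₗ[ℂ] ℂ).rTensor A (Q.T₁' (x ⊗ₜ y))) = y * x := by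
  have nat : ∀ (f : A →ₗ[ℂ] A) (w : A ⊗[ℂ] A),
      TensorProduct.lid ℂ A ((ε : A →ₗ[ℂ] ℂ).rTensor A (f.lTensor A w)) =
        f (TensorProduct.lid ℂ A ((ε : A →ₗ[ℂ] ℂ).rTensor A w)) := by
    intro f w
    induction w with
    | zero => simp
    | add x y hx hy => simp only [map_add, hx, hy]
    | tmul x y => simp
  refine Q.ext_mul_right fun z => ?_
  rw [← mulRight_apply (R := ℂ), ← nat, T₁'_lTensor, nat, hε.1, mulLeft_apply, mul_assoc]

/-- Every functional `θ(y ·)` thus factors through `ε` via a map that commutes with `T₂`. -/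
theorem IsCounit.legMap (hε : Q.IsCounit ε) (θ : A →ₗ[ℂ] ℂ) (y x : A) :
    ε (Q.legMap θ y x) = θ (y * x) := by
  rw [← hε.lid_T₁', legMap_apply]
  induction Q.T₁' (x ⊗ₜ y) with
  | zero => simp
  | add x y hx hy => simp only [map_add, hx, hy]
  | tmul x y => simp [mul_comm]

theorem exists_mul_ne_zero (Q : AlgebraicQuantumGroup A) : ∃ a b : A, a * b ≠ 0 := by
  by_contra! H
  exact Q.φ_ne_zero (LinearMap.ext fun a => by simp [Q.eq_zero_of_mul_right a (H a)])

theorem IsCounit.exists_eq_one (hε : Q.IsCounit ε) : ∃ a, ε a = 1 := by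
  by_contra! H
  have H' : ∀ a, ε a = 0 := by
    intro a
    by_contra h
    exact H ((ε a)⁻¹ • a) (by rw [map_smul, smul_eq_mul, inv_mul_cancel₀ h])
  obtain ⟨a, b, hab⟩ := Q.exists_mul_ne_zero
  have h0 : (ε : A →ₗ[ℂ] ℂ) = 0 := LinearMap.ext H'
  exact hab (by rw [← hε.slice_T₂, h0]; simp [slice])

/-- `A² = A`. -/
theorem IsCounit.mul_induction (hε : Q.IsCounit ε) {p : A → Prop} (mul : ∀ a b, p (a * b))
    (add : ∀ a b, p a → p b → p (a + b)) (a : A) : p a := by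
  obtain ⟨b, hb⟩ := hε.exists_eq_one
  have : a = mul' ℂ A (Q.T₂.symm (a ⊗ₜ b)) := by
    rw [← hε.slice_eq, slice_tmul]
    change a = ε b • a
    rw [hb, one_smul]
  rw [this]
  induction Q.T₂.symm (a ⊗ₜ b) with
  | zero => simpa using mul 0 0
  | add x y hx hy => rw [map_add]; exact add _ _ hx hy
  | tmul x y => exact mul x y

theorem IsCounit.linearMap_ext (hε : Q.IsCounit ε) {M : Type*} [AddCommGroup M] [Module ℂ M]
    {f g : A →ₗ[ℂ] M} (h : ∀ a b, f (a * b) = g (a * b)) : f = g :=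
  LinearMap.ext <| hε.mul_induction h fun a b ha hb => by rw [map_add, map_add, ha, hb]

theorem IsCounit.unique {ε' : A →ₙₐ[ℂ] ℂ} (hε : Q.IsCounit ε) (hε' : Q.IsCounit ε') :
    ε = ε' := by
  ext a
  obtain ⟨b, c, hbc⟩ := Q.exists_mul_ne_zero
  have h := (hε.slice_eq ((b * c) ⊗ₜ a)).trans (hε'.slice_eq ((b * c) ⊗ₜ a)).symm
  rw [slice_tmul, slice_tmul] at h
  exact smul_left_injective ℂ hbc h

end Counit

section Integral

variable {Q} {ε : A →ₙₐ[ℂ] ℂ} {h : A}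

/-- For `z = (b ⊗ 1)Δ(x)` this is `zΔ(h) = (b ⊗ 1)Δ(xh) = ε(x)(b ⊗ 1)Δ(h)`, and such `z` span. -/
theorem Δ_right_integral (hh : ∀ a, a * h = ε a • h) (z : A ⊗[ℂ] A) :
    (Q.Δ h).right z = Q.T₂ (slice (ε : A →ₗ[ℂ] ℂ) (Q.T₂.symm z) ⊗ₜ h) := by
  obtain ⟨w, rfl⟩ := Q.T₂.surjective z
  rw [LinearEquiv.symm_apply_apply]
  induction w with
  | zero => simp
  | add x y hx hy => simp only [map_add, hx, hy, add_tmul]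
  | tmul b x =>
    rw [Δ_right_T₂, hh, slice_tmul, tmul_smul, smul_tmul']
    rfl

/-- The slices `(ω ⊗ ι)Δ(h)` of a left integral separate functionals. -/
theorem eq_zero_of_slice_integral (hε : Q.IsCounit ε) (h0 : h ≠ 0) (hh : ∀ a, a * h = ε a • h)
    {θ : A →ₗ[ℂ] ℂ} (hθ : ∀ b, slice θ (Q.T₂ (b ⊗ₜ h)) = 0) : θ = 0 := by
  -- By the integral property `(b ⊗ y)Δ(h)` is again of the form `(b' ⊗ 1)Δ(h)`, which `ι ⊗ θ`
  -- kills.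
  have h1 : ∀ y, Q.legMap θ y h = 0 := fun y => Q.eq_zero_of_mul_left _ fun b => by
    rw [mul_legMap, ← slice_lTensor, ← Δ_right_tmul, Δ_right_integral hh, hθ]
  -- The second leg of `T₂⁻¹(c ⊗ x)` lies in the common kernel of all `θ(y ·)`, since these are `ε ∘
  -- legMap θ y` and leg maps commute with `T₂⁻¹`. On that kernel `θ(y a n) = 0` for all `a`,
  -- whereas multiplying the legs of `T₂⁻¹(c ⊗ x)` gives `ε(x)c`.
  have h2 : ∀ x, (∀ y, Q.legMap θ y x = 0) → ∀ y c, ε x * θ (y * c) = 0 := by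
    intro x hx y c
    let g : A →ₗ[ℂ] A →ₗ[ℂ] ℂ :=
      LinearMap.mk₂ ℂ (fun n a => θ (y * (a * n))) (by intros; simp [mul_add])
        (by intros; simp [mul_smul_comm]) (by intros; simp [add_mul, mul_add])
        (by intros; simp [mul_smul_comm, smul_mul_assoc])
    have h3 : g.lTensor A (Q.T₂.symm (c ⊗ₜ x)) = 0 := by
      refine lTensor_eq_zero_of_forall (fun y : A => θ ∘ₗ mulLeft ℂ y) g
        (fun n hn => LinearMap.ext fun a => ?_) _ fun y => ?_
      · have := hn (y * a)
        simpa [g, mul_assoc] using this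
      · apply lTensor_eq_zero_of_slice
        have h4 := Q.legMap_T₂_symm θ y (c ⊗ₜ x)
        rw [lTensor_tmul, hx, tmul_zero, map_zero] at h4
        have h5 : θ ∘ₗ mulLeft ℂ y = (ε : A →ₗ[ℂ] ℂ) ∘ₗ Q.legMap θ y :=
          LinearMap.ext fun x => (hε.legMap θ y x).symm
        rw [h5, ← slice_lTensor, h4, map_zero]
    have h6 : θ (y * mul' ℂ A (Q.T₂.symm (c ⊗ₜ x))) = 0 := by
      have h7 : ∀ z : A ⊗[ℂ] A, θ (y * mul' ℂ A z) =
          TensorProduct.lift (LinearMap.applyₗ (R := ℂ) (M := A) (M₂ := ℂ)) (g.lTensor A z) := by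
        intro z
        induction z with
        | zero => simp
        | add x y hx hy => simp only [map_add, mul_add, hx, hy]
        | tmul a n => simp [g]
      rw [h7, h3, map_zero]
    rw [← hε.slice_eq, slice_tmul, mul_smul_comm, map_smul] at h6
    exact h6
  by_contra hne
  obtain ⟨y, c, hyc⟩ : ∃ y c, θ (y * c) ≠ 0 := by
    by_contra! H
    exact hne (hε.linearMap_ext fun a b => by simpa using H a b)
  -- The second leg of `(b ⊗ 1)Δ(h)` is killed by all leg maps, hence by `ε`; but `ι ⊗ ε` sends this
  -- tensor to `bh`.
  have h3 : ∀ b, b * h = 0 := fun b => by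
    rw [← hε.slice_T₂]
    have := lTensor_eq_zero_of_forall (fun y : A => Q.legMap θ y) (ε : A →ₗ[ℂ] ℂ)
      (fun x hx => (mul_eq_zero.1 (h2 x hx y c)).resolve_right hyc) (Q.T₂ (b ⊗ₜ h)) fun y => by
        rw [legMap_T₂, h1, tmul_zero, map_zero]
    rw [slice, comp_apply, this, map_zero]
  exact h0 (Q.eq_zero_of_mul_left _ h3)

end Integral

end AlgebraicQuantumGroup

/-! ### Faithfulness of `φ`, normalized integrals and finiteness of `Ax` -/

namespace AlgebraicQuantumGroup

variable {A : Type u} [NonUnitalRing A] [Module ℂ A] [IsScalarTower ℂ A A] [SMulCommClass ℂ A A]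
  [StarRing A] [StarModule ℂ A]

theorem T₁'_mul_tmul (Q : AlgebraicQuantumGroup A) (a b c : A) :
    Q.T₁' (a ⊗ₜ (b * c)) = (mulLeft ℂ b).lTensor A (Q.T₁' (a ⊗ₜ c)) :=
  Q.tensor_ext fun w => by
    rw [lTensor_mulLeft_mul, T₁'_mul, T₁'_mul, ← lTensor_comp_apply, mulLeft_mul]

section Integral

variable {Q : AlgebraicQuantumGroup A} {ε : A →ₙₐ[ℂ] ℂ} {h : A}

theorem φ_integral_ne_zero (hε : Q.IsCounit ε) (h0 : h ≠ 0) (hh : ∀ a, a * h = ε a • h) :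
    Q.φ h ≠ 0 := fun H =>
  Q.φ_ne_zero (eq_zero_of_slice_integral hε h0 hh fun b => by rw [slice_φ_T₂, H, zero_smul])

/-- Let `N` be the space of `n` with `φ(n ·) = 0`. By left invariance, the second leg of `(b ⊗
1)Δ(x)` stays in `N` when `x ∈ N`; this drives the proof of faithfulness. -/
theorem slice_φ_mulRight_T₂ {x : A} (hx : ∀ y, Q.φ (x * y) = 0) (b y : A) :
    slice (Q.φ ∘ₗ mulRight ℂ y) (Q.T₂ (b ⊗ₜ x)) = 0 := by
  have h1 : ∀ w, slice Q.φ ((Q.Δ x).left w) = 0 := by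
    intro w
    obtain ⟨w, rfl⟩ := Q.T₃.surjective w
    induction w with
    | zero => simp
    | add x y hx hy => simp only [map_add, hx, hy, add_zero]
    | tmul a b => rw [Δ_left_T₃, slice_φ_T₃, hx, zero_smul]
  refine Q.eq_zero_of_mul_right _ fun z => ?_
  rw [← mulRight_apply (R := ℂ), ← slice_rTensor, ← rTensor_T₃, slice_rTensor, ← slice_lTensor,
    ← Δ_left_tmul, h1, map_zero]

theorem mul_legMap_slice (w : A ⊗[ℂ] A) :
    mul' ℂ A ((slice Q.φ ∘ₗ Q.T₁' ∘ₗ TensorProduct.mk ℂ A A h).lTensor A w) =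
      slice Q.φ ((Q.Δ h).right w) := by
  induction w with
  | zero => simp
  | add x y hx hy => simp only [map_add, hx, hy]
  | tmul b n => rw [Δ_right_tmul, slice_lTensor, ← mul_legMap]; rfl

/-- The left invariant functional is faithful. -/
theorem eq_zero_of_φ_mul (hε : Q.IsCounit ε) (h0 : h ≠ 0) (hh : ∀ a, a * h = ε a • h)
    {x : A} (hx : ∀ y, Q.φ (x * y) = 0) : x = 0 := by
  have h1 : ∀ n, (∀ y, (Q.φ ∘ₗ mulRight ℂ y) n = 0) →
      (slice Q.φ ∘ₗ Q.T₁' ∘ₗ TensorProduct.mk ℂ A A h) n = 0 := fun n hn =>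
    Q.eq_zero_of_mul_left _ fun b => by
      refine (Q.mul_legMap Q.φ b n h).trans ?_
      have : Q.φ ∘ₗ mulLeft ℂ n = 0 := LinearMap.ext hn
      rw [this]
      simp [slice]
  -- Apply `ι ⊗ φ` to `(b ⊗ 1)Δ(n)Δ(h) = (b ⊗ 1)Δ(nh)`. The right side gives `ε(n)φ(h)b`. The left
  -- side vanishes by `h1`, since the second leg of `(b ⊗ 1)Δ(n)` lies in `N`. Hence `ε = 0` on `N`.
  have h2 : ∀ n, (∀ y, (Q.φ ∘ₗ mulRight ℂ y) n = 0) → (ε : A →ₗ[ℂ] ℂ) n = 0 := by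
    intro n hn
    obtain ⟨b, c, hbc⟩ := Q.exists_mul_ne_zero
    have h3 := mul_legMap_slice (Q := Q) (h := h) (Q.T₂ (b ⊗ₜ n))
    rw [lTensor_eq_zero_of_forall (fun y : A => Q.φ ∘ₗ mulRight ℂ y) _ h1 _
      fun y => lTensor_eq_zero_of_slice (slice_φ_mulRight_T₂ hn b y), map_zero, Δ_right_T₂,
      slice_φ_T₂, hh, map_smul] at h3
    have h4 := (smul_eq_zero.1 h3.symm).resolve_right (left_ne_zero_of_mul hbc)
    exact (mul_eq_zero.1 h4).resolve_right (φ_integral_ne_zero hε h0 hh)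
  refine Q.eq_zero_of_mul_left _ fun b => ?_
  rw [← hε.slice_T₂, slice, comp_apply, lTensor_eq_zero_of_forall (fun y : A => Q.φ ∘ₗ mulRight ℂ y)
    _ h2 _ fun y => lTensor_eq_zero_of_slice (slice_φ_mulRight_T₂ hx b y), map_zero]

/-- Polarization: the imaginary parts of `φ(z* z)` vanish for `z = a + b` and `z = a + ib`. -/
theorem φ_star_mul (Q : AlgebraicQuantumGroup A) (a b : A) :
    Q.φ (star b * a) = starRingEnd ℂ (Q.φ (star a * b)) := by
  have h1 := (Q.φ_pos (a + b)).2
  have h2 := (Q.φ_pos (a + Complex.I • b)).2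
  have ha := (Q.φ_pos a).2
  have hb := (Q.φ_pos b).2
  simp only [star_add, star_smul, add_mul, mul_add, map_add, smul_mul_assoc, mul_smul_comm,
    map_smul, Complex.add_im, smul_eq_mul, Complex.star_def, Complex.conj_I, Complex.mul_im,
    Complex.mul_re, Complex.I_re, Complex.I_im, Complex.neg_re, Complex.neg_im, ha, hb] at h1 h2
  apply Complex.ext
  · simp only [Complex.conj_re]; linarith
  · simp only [Complex.conj_im]; linarith

theorem IsCounit.φ_star (hε : Q.IsCounit ε) (a : A) : Q.φ (star a) = starRingEnd ℂ (Q.φ a) := by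
  induction a using hε.mul_induction with
  | mul a b =>
    rw [star_mul]
    simpa using Q.φ_star_mul (star a) b
  | add a b ha hb => rw [star_add, map_add, map_add, map_add, ha, hb]

/-- The semi-inner product `φ(x* y)`. -/
@[reducible] def preCore (Q : AlgebraicQuantumGroup A) : PreInnerProductSpace.Core ℂ A where
  inner x y := Q.φ (star x * y)
  conj_inner_symm x y := (Q.φ_star_mul y x).symm
  re_inner_nonneg x := (Q.φ_pos x).1
  add_left x y z := by simp [add_mul]
  smul_left x y r := by simp [smul_mul_assoc]

theorem eq_zero_of_mul_φ (hε : Q.IsCounit ε) (h0 : h ≠ 0) (hh : ∀ a, a * h = ε a • h)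
    {x : A} (hx : ∀ y, Q.φ (y * x) = 0) : x = 0 := by
  rw [← star_eq_zero]
  refine eq_zero_of_φ_mul hε h0 hh fun y => ?_
  rw [← star_star y, ← star_mul, hε.φ_star, hx, map_zero]

theorem eq_zero_of_φ_star_mul_self (hε : Q.IsCounit ε) (h0 : h ≠ 0) (hh : ∀ a, a * h = ε a • h)
    {x : A} (hx : Q.φ (star x * x) = 0) : x = 0 := by
  refine eq_zero_of_mul_φ hε h0 hh fun y => ?_
  let := Q.preCore
  -- Cauchy–Schwarz: `|φ(yx)|² ≤ φ(yy*)φ(x*x) = 0`.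
  have h1 := InnerProductSpace.Core.inner_mul_inner_self_le (𝕜 := ℂ) (star y) x
  change ‖Q.φ (star (star y) * x)‖ * ‖Q.φ (star x * star y)‖ ≤
    RCLike.re (Q.φ (star (star y) * star y)) * RCLike.re (Q.φ (star x * x)) at h1
  rw [hx, map_zero, mul_zero, Q.φ_star_mul (star y) x, star_star, RCLike.norm_conj] at h1
  exact norm_eq_zero.1 (mul_self_eq_zero.1 (le_antisymm h1 (mul_self_nonneg _)))

/-- The inner product `φ(x* y)`. -/
@[reducible] def core (hε : Q.IsCounit ε) (h0 : h ≠ 0) (hh : ∀ a, a * h = ε a • h) :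
    InnerProductSpace.Core ℂ A :=
  { Q.preCore with definite := fun _ hx => eq_zero_of_φ_star_mul_self hε h0 hh hx }

theorem star_mul_self_ne_zero (hε : Q.IsCounit ε) (h0 : h ≠ 0) (hh : ∀ a, a * h = ε a • h)
    {x : A} (hx : x ≠ 0) : star x * x ≠ 0 := fun H =>
  hx (eq_zero_of_φ_star_mul_self hε h0 hh (by rw [H, map_zero]))

theorem star_integral_mul (hh : ∀ a, a * h = ε a • h) (a : A) :
    star h * a = starRingEnd ℂ (ε (star a)) • star h := by
  rw [← star_star a, ← star_mul, hh, star_smul, star_star]; rfl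

/-- Evaluate `h* a h` in both bracketings and cancel `h* h ≠ 0`. -/
theorem counit_star (hε : Q.IsCounit ε) (h0 : h ≠ 0) (hh : ∀ a, a * h = ε a • h) (a : A) :
    ε (star a) = starRingEnd ℂ (ε a) := by
  have h1 : star h * a * h = star h * (a * h) := mul_assoc _ _ _
  rw [star_integral_mul hh, smul_mul_assoc, hh a, mul_smul_comm] at h1
  rw [← smul_left_injective ℂ (star_mul_self_ne_zero hε h0 hh h0) h1, starRingEnd_self_apply]

/-- A discrete algebraic quantum group has a self-adjoint two-sided integral `h` with
`ε(h) = 1`. -/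
theorem IsDiscrete.exists_integral (hQ : Q.IsDiscrete) :
    ∃ (ε : A →ₙₐ[ℂ] ℂ) (h : A), Q.IsCounit ε ∧ h ≠ 0 ∧ (∀ a, a * h = ε a • h) ∧
      (∀ a, h * a = ε a • h) ∧ ε h = 1 ∧ star h = h := by
  obtain ⟨ε, hε, h, h0, hh⟩ := hQ
  have h1 : ε h ≠ 0 := fun H => by
    apply star_mul_self_ne_zero hε h0 hh h0
    rw [star_integral_mul hh, counit_star hε h0 hh, H, map_zero, map_zero, zero_smul]
  have h2 : star h * h = ε h • star h := by
    rw [star_integral_mul hh, counit_star hε h0 hh, starRingEnd_self_apply]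
  set k := (ε h)⁻¹ • h with hk
  have k0 : k ≠ 0 := smul_ne_zero (inv_ne_zero h1) h0
  have kk : ∀ a, a * k = ε a • k := fun a => by rw [hk, mul_smul_comm, hh, smul_comm]
  have k1 : ε k = 1 := by rw [hk, map_smul, smul_eq_mul, inv_mul_cancel₀ h1]
  -- `k* k = k*` because `ε(k) = 1`, and the left side is self-adjoint.
  have k2 : star k = k := by
    have h3 := star_integral_mul kk k
    rw [counit_star hε k0 kk, starRingEnd_self_apply, k1, one_smul] at h3
    have h4 := congrArg star h3
    rw [star_mul, star_star, h3] at h4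
    exact h4
  refine ⟨ε, k, hε, k0, kk, fun a => ?_, k1, k2⟩
  have h3 := star_integral_mul kk a
  rwa [counit_star hε k0 kk, starRingEnd_self_apply, k2] at h3

/-- The map `R(y) = (ι ⊗ φ)((1 ⊗ y)Δ(h))` is injective, because slices of `Δ(h)` separate
functionals and `φ` is faithful. Moreover `R(yx)` is the slice by `φ(y ·)` of the single tensor `(1
⊗ x)Δ(h)`, so `R` maps `Ax` into a finite dimensional space. -/
theorem finiteDimensional_range_mulRight (hε : Q.IsCounit ε) (h0 : h ≠ 0)
    (hh : ∀ a, a * h = ε a • h) (x : A) : FiniteDimensional ℂ (range (mulRight ℂ x)) := by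
  obtain ⟨F, _, hF⟩ := exists_finiteDimensional_slice (Q.T₁' (h ⊗ₜ x))
  let R : A →ₗ[ℂ] A := slice Q.φ ∘ₗ Q.T₁' ∘ₗ TensorProduct.mk ℂ A A h
  have hR : Function.Injective R := by
    rw [← ker_eq_bot, ker_eq_bot']
    intro y hy
    refine eq_zero_of_φ_mul hε h0 hh fun z => ?_
    have : Q.φ ∘ₗ mulLeft ℂ y = 0 := eq_zero_of_slice_integral hε h0 hh fun b => by
      rw [← mul_legMap]
      change b * R y = 0
      rw [hy, mul_zero]
    exact LinearMap.congr_fun this z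
  have hRF : ∀ y ∈ range (mulRight ℂ x), R y ∈ F := by
    rintro _ ⟨y, rfl⟩
    change slice Q.φ (Q.T₁' (h ⊗ₜ (y * x))) ∈ F
    rw [T₁'_mul_tmul, slice_lTensor]
    exact hF _
  exact FiniteDimensional.of_injective (R.restrict hRF) fun y z hyz =>
    Subtype.ext (hR (congrArg Subtype.val hyz))

end Integral

end AlgebraicQuantumGroup

/-! ### Minimal projections -/

section MinimalProjections

variable {A : Type u} [NonUnitalRing A] [Module ℂ A] [IsScalarTower ℂ A A] [SMulCommClass ℂ A A]
  [StarRing A]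

/-- A projection `p ≠ 0` with `pAp = ℂp`. -/
structure IsMinimalProjection (p : A) : Prop where
  ne_zero : p ≠ 0
  star_eq : star p = p
  mul_self : p * p = p
  exists_smul : ∀ x, ∃ r : ℂ, p * x * p = r • p

theorem exists_minimal_left_ideal (fd : ∀ a : A, FiniteDimensional ℂ (range (mulRight ℂ a)))
    {a b : A} (hab : b * a ≠ 0) :
    ∃ L : Submodule ℂ A, L ≠ ⊥ ∧ FiniteDimensional ℂ L ∧ (∀ x, ∀ l ∈ L, x * l ∈ L) ∧
      L ≤ range (mulRight ℂ a) ∧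
      ∀ L' : Submodule ℂ A, L' ≠ ⊥ → (∀ x, ∀ l ∈ L', x * l ∈ L') → L' ≤ L → L' = L := by
  classical
  have hex : ∃ n, ∃ L : Submodule ℂ A, L ≠ ⊥ ∧ (∀ x, ∀ l ∈ L, x * l ∈ L) ∧
      L ≤ range (mulRight ℂ a) ∧ Module.finrank ℂ L = n :=
    ⟨_, range (mulRight ℂ a), fun h => hab <| (Submodule.mem_bot ℂ).1 (h ▸ ⟨b, rfl⟩), by
      rintro x _ ⟨y, rfl⟩
      exact ⟨x * y, mul_assoc _ _ _⟩, le_rfl, rfl⟩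
  obtain ⟨L, h0, hL, hLa, hn⟩ := Nat.find_spec hex
  have := fd a
  have hfd : FiniteDimensional ℂ L := Submodule.finiteDimensional_of_le hLa
  refine ⟨L, h0, hfd, hL, hLa, fun L' h0' hL' hle => ?_⟩
  refine Submodule.eq_of_le_of_finrank_le hle ?_
  rw [hn]
  exact Nat.find_min' hex ⟨L', h0', hL', hle.trans hLa, rfl⟩

/-- A minimal left ideal `L ⊆ Aa` contains a self-adjoint `y ≠ 0`. By minimality right
multiplication by `y` is bijective on `L`, and the `e ∈ L` with `ey = y` turns out to be a
projection. Schur's lemma gives `eAe = ℂe`. -/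
theorem exists_minimalProjection (fd : ∀ a : A, FiniteDimensional ℂ (range (mulRight ℂ a)))
    (def0 : ∀ x : A, star x * x = 0 → x = 0) {a : A} (ha : a ≠ 0) :
    ∃ y, IsMinimalProjection (y * a) := by
  obtain ⟨L, h0, _, hL, hLa, hmin⟩ := exists_minimal_left_ideal fd (fun h => ha (def0 a h))
  obtain ⟨x, hx, hx0⟩ := Submodule.exists_mem_ne_zero_of_ne_bot h0
  obtain ⟨y, hy, hy0, hys⟩ : ∃ y ∈ L, y ≠ 0 ∧ star y = y :=
    ⟨star x * x, hL _ _ hx, fun h => hx0 (def0 x h), by simp⟩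
  have hyy : y * y ≠ 0 := fun h => hy0 (def0 y (by rwa [hys]))
  have hLy : L.map (mulRight ℂ y) = L := by
    refine hmin _ (fun h => hyy <| (Submodule.mem_bot ℂ).1 (h ▸ ⟨y, hy, rfl⟩)) ?_ ?_
    · rintro x _ ⟨l, hl, rfl⟩
      exact ⟨x * l, hL _ _ hl, by simp [mul_assoc]⟩
    · rintro _ ⟨l, hl, rfl⟩
      exact hL _ _ hy
  have hinj : ∀ z ∈ L, z * y = 0 → z = 0 := by
    intro z hz hzy
    by_contra hz0
    have h1 : L ⊓ ker (mulRight ℂ y) = L := by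
      refine hmin _ (fun h => hz0 <| (Submodule.mem_bot ℂ).1 (h ▸ ⟨hz, hzy⟩)) ?_ inf_le_left
      rintro x l ⟨hl, hl'⟩
      exact ⟨hL _ _ hl, by simpa [mul_assoc] using congrArg (x * ·) hl'⟩
    exact hyy (h1.ge hy).2
  have hinj' : ∀ z ∈ L, ∀ w ∈ L, z * y = w * y → z = w := fun z hz w hw h =>
    sub_eq_zero.1 (hinj _ (sub_mem hz hw) (by rw [sub_mul, h, sub_self]))
  obtain ⟨e, he, hey⟩ := hLy.ge hy
  replace hey : e * y = y := hey
  have hee : e * e = e := hinj' _ (hL _ _ he) _ he (by rw [mul_assoc, hey, hey])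
  have hye : y * e = y := hinj' _ (hL _ _ he) _ hy (by rw [mul_assoc, hey])
  have hey' : star e * y = y := by simpa [hys] using congrArg star hye
  -- This one identity makes `e` self-adjoint, since `e* e` is.
  have hse : star e * e = e := hinj' _ (hL _ _ he) _ he (by rw [mul_assoc, hey, hey'])
  have he0 : e ≠ 0 := by
    rintro rfl
    exact hy0 (by rw [← hey, zero_mul])
  have hs : star e = e := by
    have := congrArg star hse
    rwa [star_mul, star_star, hse, eq_comm] at this
  obtain ⟨b, hb⟩ := hLa he
  replace hb : b * a = e := hb
  refine ⟨b, hb ▸ ⟨he0, hs, hee, fun z => ?_⟩⟩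
  have hLw : ∀ l ∈ L, mulRight ℂ (e * z * e) l ∈ L := fun l _ => by
    rw [mulRight_apply, ← mul_assoc]
    exact hL _ _ he
  have : Nontrivial L := (Submodule.nontrivial_iff_ne_bot).2 h0
  -- Schur's lemma: an eigenspace of right multiplication by `eze` on `L` is a non-zero left ideal,
  -- hence all of `L`, and in particular contains `e`.
  obtain ⟨r, hr⟩ := Module.End.exists_eigenvalue ((mulRight ℂ (e * z * e)).restrict hLw)
  obtain ⟨v, hv⟩ := hr.exists_hasEigenvector
  have hv1 : (v : A) * (e * z * e) = r • (v : A) := congrArg Subtype.val hv.apply_eq_smul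
  have hE : L ⊓ ker (mulRight ℂ (e * z * e) - r • LinearMap.id) = L := by
    refine hmin _ (fun h => hv.2 ?_) ?_ inf_le_left
    · refine Subtype.ext ((Submodule.mem_bot ℂ).1 (h ▸ ⟨v.2, ?_⟩))
      exact sub_eq_zero.2 hv1
    · rintro x l ⟨hl, hl'⟩
      replace hl' : l * (e * z * e) = r • l := sub_eq_zero.1 hl'
      exact ⟨hL _ _ hl, sub_eq_zero.2 (by
        rw [mulRight_apply, mul_assoc, hl', mul_smul_comm]; rfl)⟩
  have he' : e * (e * z * e) = r • e := sub_eq_zero.1 (hE.ge he).2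
  exact ⟨r, by rw [← he', ← mul_assoc, ← mul_assoc, hee]⟩

/-- Zorn's lemma picks one minimal projection from each block: `pAq = 0` says that `p` and `q` lie
in different blocks. -/
theorem exists_maximal_minimalProjections : ∃ S : Set A, (∀ p ∈ S, IsMinimalProjection p) ∧
    (∀ p ∈ S, ∀ q ∈ S, p ≠ q → ∀ x, p * x * q = 0) ∧
    ∀ q, IsMinimalProjection q → ∃ p ∈ S, ∃ x, p * x * q ≠ 0 := by
  obtain ⟨S, hS⟩ := zorn_subset {S : Set A | (∀ p ∈ S, IsMinimalProjection p) ∧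
      S.Pairwise fun p q => ∀ x, p * x * q = 0} fun c hc hchain => by
    refine ⟨⋃₀ c, ⟨?_, ?_⟩, fun s hs => Set.subset_sUnion_of_mem hs⟩
    · rintro p ⟨s, hs, hp⟩
      exact (hc hs).1 p hp
    · exact (Set.pairwise_sUnion hchain.directedOn).2 fun s hs => (hc hs).2
  refine ⟨S, hS.prop.1, fun p hp q hq => hS.prop.2 hp hq, fun q hq => ?_⟩
  by_contra! H
  have hins : insert q S ∈ {S : Set A | (∀ p ∈ S, IsMinimalProjection p) ∧
      S.Pairwise fun p q => ∀ x, p * x * q = 0} := by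
    refine ⟨?_, ?_⟩
    · rintro p (rfl | hp)
      · exact hq
      · exact hS.prop.1 p hp
    · refine hS.prop.2.insert fun p hp _ => ⟨fun x => ?_, H p hp⟩
      have := congrArg star (H p hp (star x))
      rw [star_mul, star_mul, star_star, star_zero, hq.star_eq, (hS.prop.1 p hp).star_eq] at this
      rw [mul_assoc, this]
  have hmem : q ∈ S := hS.le_of_ge hins (Set.subset_insert q S) (Set.mem_insert q S)
  exact hq.ne_zero (by rw [← H q hmem q, hq.mul_self, hq.mul_self])

/-- A non-zero `a` would give a minimal projection `q = ya`. It is linked to some `p ∈ S` by `pxq ≠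
0`, and `(pxq)*(pxq)` is then a non-zero multiple of `q`. Rewriting its leftmost `q` as `ya`
exhibits a factor in `aAp = 0`. -/
theorem eq_zero_of_minimalProjections
    (fd : ∀ a : A, FiniteDimensional ℂ (range (mulRight ℂ a)))
    (def0 : ∀ x : A, star x * x = 0 → x = 0) {S : Set A}
    (hS : ∀ p ∈ S, IsMinimalProjection p)
    (hmax : ∀ q, IsMinimalProjection q → ∃ p ∈ S, ∃ x, p * x * q ≠ 0) {a : A}
    (ha : ∀ p ∈ S, ∀ x, a * (x * p) = 0) : a = 0 := by
  by_contra h0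
  obtain ⟨y, hq⟩ := exists_minimalProjection fd def0 h0
  obtain ⟨p, hp, x, hx⟩ := hmax _ hq
  obtain ⟨q, hqa⟩ : ∃ q, q = y * a := ⟨_, rfl⟩
  rw [← hqa] at hq hx
  obtain ⟨r, hr⟩ := hq.exists_smul (star x * p * x)
  have hw : star (p * x * q) * (p * x * q) = r • q := by
    rw [← hr, star_mul, star_mul, hq.star_eq, (hS p hp).star_eq]
    simp only [mul_assoc]
    rw [← mul_assoc p p, (hS p hp).mul_self]
  have hr0 : r ≠ 0 := by
    rintro rfl
    exact hx (def0 _ (by rw [hw, zero_smul]))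
  have h1 : r • q = 0 := by
    calc r • q = q * (r • q) := by rw [mul_smul_comm, hq.mul_self]
      _ = q * (star (p * x * q) * (p * x * q)) := by rw [hw]
      _ = y * (a * ((q * star x) * p)) * (p * x * q) := by
        nth_rewrite 1 [hqa]
        rw [star_mul, star_mul, hq.star_eq, (hS p hp).star_eq]
        simp only [mul_assoc]
      _ = 0 := by rw [ha p hp, mul_zero, zero_mul]
  exact hq.ne_zero ((smul_eq_zero.1 h1).resolve_left hr0)

end MinimalProjections

/-! ### The matrix blocks of `A` -/

section Representations

variable {A : Type u} [NonUnitalRing A] [Module ℂ A] [IsScalarTower ℂ A A] [SMulCommClass ℂ A A]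
  [StarRing A] [StarModule ℂ A] {φ : A →ₗ[ℂ] ℂ} (c : InnerProductSpace.Core ℂ A)
  (hc : ∀ x y, c.inner x y = φ (star x * y))

include hc

theorem exists_orthonormal (V : Submodule ℂ A) [FiniteDimensional ℂ V] :
    ∃ v : Fin (Module.finrank ℂ V) → A, (∀ k, v k ∈ V) ∧
      (∀ j k, φ (star (v j) * v k) = if j = k then 1 else 0) ∧
      ∀ z ∈ V, z = ∑ k, φ (star (v k) * z) • v k := by
  let : NormedAddCommGroup A := c.toNormedAddCommGroup
  let : InnerProductSpace ℂ A := InnerProductSpace.ofCore c.toCore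
  have hin : ∀ x y : A, inner ℂ x y = φ (star x * y) := hc
  let b := stdOrthonormalBasis ℂ V
  refine ⟨fun k => b k, fun k => (b k).2, fun j k => ?_, fun z hz => ?_⟩
  · rw [← hin, ← Submodule.coe_inner]
    exact orthonormal_iff_ite.1 b.orthonormal j k
  · have := congrArg Subtype.val (b.sum_repr' ⟨z, hz⟩)
    simp only [Submodule.coe_sum, Submodule.coe_smul, Submodule.coe_inner, hin] at this
    exact this.symm

theorem finite_of_orthogonal {ι : Type*} (f : ι → A) (h0 : ∀ i, f i ≠ 0)
    (hf : ∀ i j, i ≠ j → φ (star (f i) * f j) = 0) (V : Submodule ℂ A) [FiniteDimensional ℂ V]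
    (hV : ∀ i, f i ∈ V) : Finite ι := by
  let : NormedAddCommGroup A := c.toNormedAddCommGroup
  let : InnerProductSpace ℂ A := InnerProductSpace.ofCore c.toCore
  have hin : ∀ x y : A, inner ℂ x y = φ (star x * y) := hc
  have hl : LinearIndependent ℂ f := linearIndependent_of_ne_zero_of_inner_eq_zero h0
    fun i j hij => (hin _ _).trans (hf i j hij)
  have hl' : LinearIndependent ℂ fun i => (⟨f i, hV i⟩ : V) :=
    LinearIndependent.of_comp V.subtype hl
  exact hl'.finite

theorem exists_irreducible_rep {p : A} (hp : IsMinimalProjection p)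
    [FiniteDimensional ℂ (range (mulRight ℂ p))] :
    ∃ (n : ℕ) (v : Fin n → A) (π : A →⋆ₙₐ[ℂ] Matrix (Fin n) (Fin n) ℂ), 0 < n ∧
      (∀ k, v k * p = v k) ∧ (∀ a j k, π a j k = φ (star (v j) * (a * v k))) ∧
      (∀ M : Matrix (Fin n) (Fin n) ℂ,
        π (∑ j, ∑ k, (M j k * φ p) • (v j * star (v k))) = M) ∧
      ∀ z, z * p = z → z = ∑ k, φ (star (v k) * z) • v k := by
  obtain ⟨v, hv, hv1, hv2⟩ := exists_orthonormal c hc (range (mulRight ℂ p))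
  have hpV : ∀ z, z * p = z → z ∈ range (mulRight ℂ p) := fun z hz => ⟨z, hz⟩
  have hvp : ∀ k, v k * p = v k := fun k => by
    obtain ⟨y, hy⟩ := hv k
    rw [← hy, mulRight_apply, mul_assoc, hp.mul_self]
  refine ⟨_, v,
    { toFun := fun a => Matrix.of fun j k => φ (star (v j) * (a * v k))
      map_smul' := fun r a => by ext; simp [smul_mul_assoc, mul_smul_comm]
      map_zero' := by ext; simp
      map_add' := fun a b => by ext; simp [add_mul, mul_add]
      map_mul' := fun a b => by
        ext j k
        rw [Matrix.of_apply, Matrix.mul_apply, mul_assoc a b,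
          hv2 (b * v k) (hpV _ (by rw [mul_assoc, hvp]))]
        simp only [Finset.mul_sum, mul_smul_comm, map_sum, map_smul, smul_eq_mul, Matrix.of_apply]
        exact Finset.sum_congr rfl fun l _ => mul_comm _ _
      map_star' := fun a => by
        ext j k
        rw [Matrix.star_apply, Matrix.of_apply, Matrix.of_apply, ← mul_assoc, ← star_star a,
          ← star_mul, star_star, ← hc, ← c.conj_inner_symm, hc]
        rfl }, ?_, hvp, fun a j k => rfl, fun M => ?_, fun z hz => hv2 z (hpV z hz)⟩
  · rw [Module.finrank_pos_iff_exists_ne_zero]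
    exact ⟨⟨p, p, hp.mul_self⟩, fun h => hp.ne_zero (congrArg Subtype.val h)⟩
  · have hort : ∀ j k, φ p • (star (v j) * v k) = if j = k then p else 0 := by
      intro j k
      obtain ⟨r, hr⟩ := hp.exists_smul (star (v j) * v k)
      have h1 : star (v j) * v k = r • p := by
        rw [← hr, ← mul_assoc, ← hvp j, ← hvp k, star_mul, hp.star_eq]
        simp only [mul_assoc, hp.mul_self]
        rw [← mul_assoc p p, hp.mul_self]
      have h2 := hv1 j k
      rw [h1, map_smul, smul_eq_mul, mul_comm] at h2
      rw [h1, smul_smul, h2]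
      split_ifs <;> simp
    ext l m
    have h1 : ∀ j k, (M j k * φ p) * φ (star (v l) * (v j * (star (v k) * v m))) =
        if k = m then (if l = j then M j k else 0) else 0 := by
      intro j k
      rw [mul_assoc, ← smul_eq_mul (φ p), ← map_smul, ← mul_smul_comm, ← mul_smul_comm, hort]
      by_cases h2 : k = m
      · rw [if_pos h2, if_pos h2, hvp, hv1, mul_ite, mul_one, mul_zero]
      · rw [if_neg h2, if_neg h2, mul_zero, mul_zero, map_zero, mul_zero]
    change φ (star (v l) * (_ * v m)) = _
    simp only [Finset.sum_mul, Finset.mul_sum, smul_mul_assoc, mul_smul_comm, map_sum,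
      map_smul, mul_assoc, smul_eq_mul]
    simp only [mul_assoc] at h1
    simp [h1]

theorem exists_blockDecomposition (fd : ∀ a : A, FiniteDimensional ℂ (range (mulRight ℂ a))) :
    Nonempty (BlockDecomposition A) := by
  classical
  have def0 : ∀ x : A, star x * x = 0 → x = 0 := fun x hx =>
    c.definite x (by rw [hc, hx, map_zero])
  obtain ⟨S, hS, horth, hmax⟩ := exists_maximal_minimalProjections (A := A)
  have horth' : ∀ p q : S, p ≠ q → (p : A) * q = 0 := fun p q hpq => by
    rw [← horth p p.2 q q.2 (fun h => hpq (Subtype.ext h)) p, (hS p p.2).mul_self]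
  choose n v π hn hvp hπ hmat hexp using fun p : S => exists_irreducible_rep c hc (hS p p.2)
  have hvp' : ∀ (p : S) k, (p : A) * star (v p k) = star (v p k) := fun p k => by
    conv_rhs => rw [← hvp p k, star_mul, (hS p p.2).star_eq]
  have hvv : ∀ p q : S, p ≠ q → ∀ j k, star (v p j) * v q k = 0 := fun p q hpq j k => by
    rw [← hvp' p j, ← hvp q k, mul_assoc, ← mul_assoc _ _ (q : A), ← mul_assoc]
    exact horth p p.2 q q.2 (fun h => hpq (Subtype.ext h)) _
  let E : ∀ p : S, Matrix (Fin (n p)) (Fin (n p)) ℂ → A := fun p M =>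
    ∑ j, ∑ k, (M j k * φ p) • (v p j * star (v p k))
  have hE : ∀ p q M, π q (E p M) =
      (Pi.single p M : ∀ p, Matrix (Fin (n p)) (Fin (n p)) ℂ) q := by
    intro p q M
    by_cases hpq : p = q
    · subst hpq
      rw [Pi.single_eq_same, hmat]
    · rw [Pi.single_eq_of_ne (M := fun p => Matrix (Fin (n p)) (Fin (n p)) ℂ) (Ne.symm hpq)]
      ext l m
      rw [hπ]
      simp only [E, Finset.sum_mul, Finset.mul_sum, smul_mul_assoc, mul_smul_comm, mul_assoc,
        hvv p q hpq, mul_zero, smul_zero, Finset.sum_const_zero, map_zero, Matrix.zero_apply]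
  refine ⟨⟨S, n, hn, π, fun a => ?_, fun x hx => ?_⟩⟩
  · have h1 : ∀ p : {p : S | π p a ≠ 0}, ∃ j, star (v p j) * a ≠ 0 := by
      rintro ⟨p, hp⟩
      by_contra! H
      refine hp ?_
      ext j k
      rw [hπ, ← mul_assoc, H, zero_mul, map_zero, Matrix.zero_apply]
    choose j hj using h1
    have := fd a
    refine finite_of_orthogonal c hc (fun p : {p : S | π p a ≠ 0} => star (v p (j p)) * a) hj
      (fun p q hpq => ?_) (range (mulRight ℂ a)) fun p => ⟨_, rfl⟩
    rw [← hvp' p, ← hvp' q, star_mul, star_mul, star_star, (hS p p.1.2).star_eq]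
    simp only [mul_assoc]
    rw [← mul_assoc (p.1 : A) (q.1 : A), horth' _ _ fun h => hpq (Subtype.ext h)]
    simp
  · have hval : ∀ q, π q (∑ p ∈ hx.toFinset, E p (x p)) = x q := by
      intro q
      rw [map_sum]
      simp only [hE]
      by_cases hq : q ∈ hx.toFinset
      · rw [Finset.sum_eq_single_of_mem q hq fun p _ hpq =>
          Pi.single_eq_of_ne (M := fun p => Matrix (Fin (n p)) (Fin (n p)) ℂ) hpq.symm _,
          Pi.single_eq_same]
      · rw [Finset.sum_eq_zero fun p hp =>
          Pi.single_eq_of_ne (M := fun p => Matrix (Fin (n p)) (Fin (n p)) ℂ)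
            (by rintro rfl; exact hq hp) _]
        simpa [eq_comm] using hq
    refine ⟨∑ p ∈ hx.toFinset, E p (x p), hval, fun b hb => ?_⟩
    -- An element with zero image in every block annihilates every `Ap`, as the `vₖ` span `Ap`.
    · rw [← sub_eq_zero]
      refine eq_zero_of_minimalProjections fd def0 hS hmax fun p hp y => ?_
      have h2 : ∀ k, (b - ∑ p ∈ hx.toFinset, E p (x p)) * v ⟨p, hp⟩ k = 0 := by
        intro k
        rw [hexp ⟨p, hp⟩ (_ * _) (by rw [mul_assoc, hvp])]
        refine Finset.sum_eq_zero fun j _ => ?_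
        rw [← hπ, map_sub, hb, hval, sub_self, Matrix.zero_apply, zero_smul]
      rw [hexp ⟨p, hp⟩ (y * p) (by rw [mul_assoc, (hS p hp).mul_self]), Finset.mul_sum]
      exact Finset.sum_eq_zero fun k _ => by rw [mul_smul_comm, h2, smul_zero]

end Representations

/-! ### Group-like multipliers and the regular monoid -/

namespace AlgebraicQuantumGroup

variable {A : Type u} [NonUnitalRing A] [Module ℂ A] [IsScalarTower ℂ A A] [SMulCommClass ℂ A A]
  [StarRing A] [StarModule ℂ A] {Q : AlgebraicQuantumGroup A}

/-- A multiplier of `A ⊗ A` is determined by its left part. -/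
theorem multiplier_ext_left (Q : AlgebraicQuantumGroup A) {X Y : Multiplier (A ⊗[ℂ] A)}
    (h : ∀ z, X.left z = Y.left z) : X = Y :=
  Multiplier.ext' h fun b => Q.tensor_ext fun u => by
    rw [Multiplier.central, Multiplier.central, h]

theorem left_right_comm (Q : AlgebraicQuantumGroup A) (X Y : Multiplier (A ⊗[ℂ] A))
    (z : A ⊗[ℂ] A) : X.left (Y.right z) = Y.right (X.left z) :=
  Q.tensor_ext fun u => by
    rw [Multiplier.central, ← Multiplier.left_mul', ← Multiplier.left_mul', Multiplier.central]

/-- The other half follows from `Δ(a)XΔ(b) = Δ(a(xb)) = Δ((ax)b) = Δ(ax)Δ(b)` and the non-degeneracy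
of `Δ`. -/
theorem comulEq_of_left {x : Multiplier A} {X : Multiplier (A ⊗[ℂ] A)}
    (h : ∀ a z, X.left ((Q.Δ a).left z) = (Q.Δ (x.left a)).left z) : Q.ComulEq x X := by
  have h1 : ∀ a, X * Q.Δ a = Q.Δ (x.left a) := fun a => Q.multiplier_ext_left (h a)
  refine fun a => ⟨h1 a, Q.multiplier_ext_left fun z => ?_⟩
  have hz : z ∈ Submodule.span ℂ {z | ∃ a y, z = (Q.Δ a).left y} := by simp [Q.span_left]
  induction hz using Submodule.span_induction with
  | mem z hz =>
    obtain ⟨b, y, rfl⟩ := hz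
    rw [Multiplier.mul_left, h, ← Δ_mul_left, ← Δ_mul_left, Multiplier.central]
  | zero => simp
  | add y z _ _ hy hz => rw [map_add, map_add, hy, hz]
  | smul r y _ hy => rw [map_smul, map_smul, hy]

/-- `(b ⊗ 1)Δ(ga) = (b ⊗ 1)(g ⊗ g)Δ(a) = (1 ⊗ g)(bg ⊗ 1)Δ(a)`. -/
theorem T₂_left {g : Multiplier A} (hg : Q.ComulEq g (Multiplier.tensor g g)) (a b : A) :
    Q.T₂ (b ⊗ₜ g.left a) = g.left.lTensor A (Q.T₂ (g.right b ⊗ₜ a)) :=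
  Q.tensor_ext fun w => by
    have nat : ∀ z w : A ⊗[ℂ] A, g.left.lTensor A z * w = g.left.lTensor A (z * w) := by
      intro z w
      induction z with
      | zero => simp
      | add x y hx hy => simp [add_mul, hx, hy]
      | tmul v v' =>
        induction w with
        | zero => simp
        | add x y hx hy => simp_all [mul_add]
        | tmul w w' => simp [Multiplier.left_mul']
    rw [nat, T₂_mul, T₂_mul, ← (hg a).1, Multiplier.mul_left, Multiplier.tensor_left]
    generalize (Q.Δ a).left w = w
    induction w with
    | zero => simp
    | add x y hx hy => simp only [map_add, hx, hy]
    | tmul v v' => simp [Multiplier.central]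

theorem T₂_right {g : Multiplier A} (hg : Q.ComulEq g (Multiplier.tensor g g)) (a b : A) :
    Q.T₂ (b ⊗ₜ g.right a) = TensorProduct.map g.right g.right (Q.T₂ (b ⊗ₜ a)) :=
  Q.tensor_ext fun w => by
    rw [← Multiplier.tensor_right, Multiplier.central, T₂_mul, T₂_mul, ← (hg a).2]
    rfl

section Integral

variable {ε : A →ₙₐ[ℂ] ℂ} {h : A}

/-- Since `h² = h` is a two-sided integral, `gh` and `hg` are the same multiple of `h`, and `ε(g ·)`
is that multiple of `ε`. -/
theorem grouplike_integral (hε : Q.IsCounit ε) (h0 : h ≠ 0) (hh : ∀ a, a * h = ε a • h)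
    (hh' : ∀ a, h * a = ε a • h) (h1 : ε h = 1) {g g' : Multiplier A}
    (hg : Q.ComulEq g (Multiplier.tensor g g)) (hgg' : g * g' = 1) :
    g.left h = h ∧ g.right h = h := by
  have hhh : h * h = h := by rw [hh, h1, one_smul]
  have hl : g.left h = ε (g.left h) • h := by
    conv_lhs => rw [← hhh, Multiplier.left_mul', hh]
  have hr : g.right h = ε (g.right h) • h := by
    conv_lhs => rw [← hhh, Multiplier.right_mul', hh']
  have hlr : ε (g.left h) = ε (g.right h) := by
    have := Multiplier.central g h h
    rw [hl, hr, smul_mul_assoc, mul_smul_comm, hhh] at this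
    exact (smul_left_injective ℂ h0 this).symm
  have hεg : ∀ a, ε (g.left a) = ε (g.left h) * ε a := by
    intro a
    have := Multiplier.central g h a
    rw [hr, smul_mul_assoc, hh', hh', smul_smul] at this
    rw [hlr]
    exact (smul_left_injective ℂ h0 this).symm
  have hone : ε (g.left h) = 1 := by
    obtain ⟨b, c, hbc⟩ := Q.exists_mul_ne_zero
    have h2 : g.left (g'.left c) = c := congrArg (fun x : Multiplier A => x.left c) hgg'
    have h3 := congrArg (slice (ε : A →ₗ[ℂ] ℂ)) (T₂_left hg (g'.left c) b)
    have h4 : (ε : A →ₗ[ℂ] ℂ) ∘ₗ g.left = ε (g.left h) • (ε : A →ₗ[ℂ] ℂ) := LinearMap.ext hεg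
    have h5 : ∀ z : A ⊗[ℂ] A, slice (ε (g.left h) • (ε : A →ₗ[ℂ] ℂ)) z =
        ε (g.left h) • slice (ε : A →ₗ[ℂ] ℂ) z := by
      intro z
      simp [slice, lTensor_smul]
    rw [slice_lTensor, h4, h5, hε.slice_T₂, hε.slice_T₂, Multiplier.central, h2] at h3
    exact (smul_left_injective ℂ hbc ((one_smul ℂ _).trans h3)).symm
  exact ⟨by rw [hl, hone, one_smul], by rw [hr, ← hlr, hone, one_smul]⟩

/-- The left invariant functional is central for invertible group-like multipliers. -/
theorem φ_grouplike_comm (hε : Q.IsCounit ε) (h0 : h ≠ 0) (hh : ∀ a, a * h = ε a • h)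
    (hh' : ∀ a, h * a = ε a • h) (h1 : ε h = 1) {g g' : Multiplier A}
    (hg : Q.ComulEq g (Multiplier.tensor g g)) (hgg' : g * g' = 1) (hg'g : g' * g = 1) (a : A) :
    Q.φ (g.left a) = Q.φ (g.right a) := by
  obtain ⟨hl, hr⟩ := grouplike_integral hε h0 hh hh' h1 hg hgg'
  have e1 : ∀ b, g.right (g'.right b) = b := fun b =>
    congrArg (fun x : Multiplier A => x.right b) hg'g
  have e2 : ∀ b, g'.right (g.right b) = b := fun b =>
    congrArg (fun x : Multiplier A => x.right b) hgg'
  -- From `gh = h`: `(b ⊗ 1)Δ(h) = (1 ⊗ g)(bg ⊗ 1)Δ(h)`, used with `bg⁻¹` in place of `b`.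
  have h2 : ∀ b, slice (Q.φ ∘ₗ g.left) (Q.T₂ (b ⊗ₜ h)) = Q.φ h • g'.right b := by
    intro b
    have := T₂_left hg h (g'.right b)
    rw [e1, hl] at this
    rw [← slice_lTensor, ← this, slice_φ_T₂]
  -- From `hg = h`: `(b ⊗ 1)Δ(h) = (b ⊗ 1)Δ(h)(g ⊗ g)`.
  have h3 : ∀ b, slice (Q.φ ∘ₗ g.right) (Q.T₂ (b ⊗ₜ h)) = Q.φ h • g'.right b := by
    intro b
    have := congrArg (slice Q.φ) (T₂_right hg h b)
    rw [hr, slice_φ_T₂] at this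
    have h4 : ∀ z : A ⊗[ℂ] A, slice Q.φ (TensorProduct.map g.right g.right z) =
        g.right (slice (Q.φ ∘ₗ g.right) z) := by
      intro z
      induction z with
      | zero => simp
      | add x y hx hy => simp only [map_add, hx, hy]
      | tmul v v' => simp
    rw [h4] at this
    rw [← map_smul, this, e2]
  have h4 : Q.φ ∘ₗ g.left - Q.φ ∘ₗ g.right = 0 := eq_zero_of_slice_integral hε h0 hh fun b => by
    have : slice (Q.φ ∘ₗ g.left - Q.φ ∘ₗ g.right) (Q.T₂ (b ⊗ₜ h)) =
        slice (Q.φ ∘ₗ g.left) (Q.T₂ (b ⊗ₜ h)) - slice (Q.φ ∘ₗ g.right) (Q.T₂ (b ⊗ₜ h)) := by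
      simp [slice, lTensor_sub]
    rw [this, h2, h3, sub_self]
  exact LinearMap.congr_fun (sub_eq_zero.1 h4) a

theorem mul'_map_φ (Q : AlgebraicQuantumGroup A) (z : A ⊗[ℂ] A) :
    mul' ℂ ℂ (TensorProduct.map Q.φ Q.φ z) = Q.φ (slice Q.φ z) := by
  induction z with
  | zero => simp
  | add x y hx hy => simp only [map_add, hx, hy]
  | tmul v v' => simp [mul_comm]

theorem dualMul_apply (Q : AlgebraicQuantumGroup A) (z : A ⊗[ℂ] A) (c : A) :
    Q.dualMul z c = mul' ℂ ℂ (TensorProduct.map Q.φ Q.φ ((Q.Δ c).left z)) := rfl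

theorem fourier_apply (Q : AlgebraicQuantumGroup A) (a c : A) : Q.fourier a c = Q.φ (c * a) := rfl

theorem fourier_injective (hε : Q.IsCounit ε) (h0 : h ≠ 0) (hh : ∀ a, a * h = ε a • h) :
    Function.Injective Q.fourier := by
  rw [← ker_eq_bot, ker_eq_bot']
  exact fun x hx => eq_zero_of_mul_φ hε h0 hh fun y => LinearMap.congr_fun hx y

/-- `φ ⊗ φ` is faithful. -/
theorem eq_zero_of_map_φ (hε : Q.IsCounit ε) (h0 : h ≠ 0) (hh : ∀ a, a * h = ε a • h)
    {u : A ⊗[ℂ] A} (hu : ∀ w, mul' ℂ ℂ (TensorProduct.map Q.φ Q.φ (u * w)) = 0) : u = 0 := by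
  refine eq_zero_of_forall_lTensor (fun b : A => Q.φ ∘ₗ mulRight ℂ b)
    (fun x hx => eq_zero_of_φ_mul hε h0 hh hx) u fun b => lTensor_eq_zero_of_slice ?_
  refine eq_zero_of_φ_mul hε h0 hh fun a => ?_
  rw [← hu (a ⊗ₜ b)]
  clear hu
  induction u with
  | zero => simp
  | add x y hx hy => simp only [map_add, add_mul, hx, hy]
  | tmul v v' => simp [smul_mul_assoc, mul_comm]

theorem IsRegularMonoid.unique (hε : Q.IsCounit ε) (h0 : h ≠ 0) (hh : ∀ a, a * h = ε a • h)
    {m m' : (A ⊗[ℂ] A) →ₗ[ℂ] A} {η η' : ℂ →ₗ[ℂ] A} (hm : Q.IsRegularMonoid m η)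
    (hm' : Q.IsRegularMonoid m' η') : m = m' ∧ η = η' := by
  obtain ⟨hm, ε₁, hε₁, hη⟩ := hm
  obtain ⟨hm', ε₂, hε₂, hη'⟩ := hm'
  refine ⟨LinearMap.ext fun z => fourier_injective hε h0 hh ?_,
    LinearMap.ext fun c => fourier_injective hε h0 hh (LinearMap.ext fun a => ?_)⟩
  · exact (LinearMap.congr_fun hm z).trans (LinearMap.congr_fun hm' z).symm
  · rw [hη, hη', hε₁.unique hε₂]

theorem existsUnique_regularMonoid (hε : Q.IsCounit ε) (h0 : h ≠ 0)
    (hh : ∀ a, a * h = ε a • h) :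
    ∃! mη : ((A ⊗[ℂ] A) →ₗ[ℂ] A) × (ℂ →ₗ[ℂ] A), Q.IsRegularMonoid mη.1 mη.2 := by
  -- The product sends `Δ(a)(b ⊗ 1)` to `φ(b)a`, because left invariance gives `(φ ⊗ φ)(Δ(c)Δ(a)(b ⊗
  -- 1)) = φ(ca)φ(b)`. The unit is `φ(h)⁻¹h`, because `φ(ah) = ε(a)φ(h)`.
  have hex : Q.IsRegularMonoid (slice Q.φ ∘ₗ Q.T₃.symm)
      ((Q.φ h)⁻¹ • LinearMap.toSpanSingleton ℂ A h) := by
    refine ⟨?_, ε, hε, fun c a => ?_⟩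
    · refine LinearMap.ext fun z => LinearMap.ext fun c => ?_
      obtain ⟨z, rfl⟩ := Q.T₃.surjective z
      rw [comp_apply, comp_apply, fourier_apply, dualMul_apply, mul'_map_φ, LinearEquiv.coe_coe,
        LinearEquiv.symm_apply_apply]
      induction z with
      | zero => simp
      | add x y hx hy => simp only [map_add, mul_add, hx, hy]
      | tmul a b => rw [Δ_left_T₃, slice_φ_T₃, slice_tmul, map_smul, mul_smul_comm, map_smul,
          smul_eq_mul, smul_eq_mul, mul_comm]
    · simp only [fourier_apply, LinearMap.smul_apply, LinearMap.toSpanSingleton_apply, hh,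
        map_smul, smul_eq_mul]
      field_simp [φ_integral_ne_zero hε h0 hh]
  exact ⟨(_, _), hex, fun mη hmη => Prod.ext_iff.2 (hmη.unique hε h0 hh hex)⟩

end Integral

end AlgebraicQuantumGroup

/-! ### Multipliers as families of matrices -/

namespace BlockDecomposition

variable {A : Type u} [NonUnitalRing A] [Module ℂ A] [IsScalarTower ℂ A A] [SMulCommClass ℂ A A]
  [StarRing A] [StarModule ℂ A] (D : BlockDecomposition A)

theorem ext {a b : A} (h : ∀ i, D.p i a = D.p i b) : a = b :=
  (D.existsUnique (fun i => D.p i b) (D.finite_support b)).unique h fun _ => rfl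

@[simp] theorem p_single_self (i : D.ι) (y : Matrix (Fin (D.n i)) (Fin (D.n i)) ℂ) :
    D.p i (D.single i y) = y := by
  classical
  have := (D.exists_single i y).choose_spec i
  rwa [Pi.single_eq_same] at this

theorem p_single_ne {i j : D.ι} (h : j ≠ i) (y : Matrix (Fin (D.n i)) (Fin (D.n i)) ℂ) :
    D.p j (D.single i y) = 0 := by
  classical
  have := (D.exists_single i y).choose_spec j
  rwa [Pi.single_eq_of_ne (M := fun j => Matrix (Fin (D.n j)) (Fin (D.n j)) ℂ) h] at this

/-- `(Iᵢx)Iᵢ = Iᵢ(xIᵢ)`: the left and right parts of a multiplier have the same components. -/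
theorem p_right_single (x : Multiplier A) (i : D.ι) :
    D.p i (x.right (D.single i 1)) = D.multiplierComponents x i := by
  have := congrArg (D.p i) (x.central (D.single i 1) (D.single i 1))
  simpa [multiplierComponents] using this

theorem p_left (x : Multiplier A) (i : D.ι) (a : A) :
    D.p i (x.left a) = D.multiplierComponents x i * D.p i a := by
  have := congrArg (D.p i) (x.central (D.single i 1) a)
  simpa [p_right_single] using this.symm

theorem p_right (x : Multiplier A) (i : D.ι) (a : A) :
    D.p i (x.right a) = D.p i a * D.multiplierComponents x i := by
  have := congrArg (D.p i) (x.central a (D.single i 1))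
  simpa [p_left] using this

theorem multiplierComponents_injective : Function.Injective D.multiplierComponents := by
  intro x y h
  refine Multiplier.ext' (fun b => D.ext fun i => ?_) (fun b => D.ext fun i => ?_)
  · rw [p_left, p_left, h]
  · rw [p_right, p_right, h]

/-- The isomorphism `M(A) → ∏ᵢ End Hᵢ` as a homomorphism. -/
noncomputable def multiplierHom :
    Multiplier A →* ∀ i, Matrix (Fin (D.n i)) (Fin (D.n i)) ℂ where
  toFun := D.multiplierComponents
  map_one' := by ext i; simp [multiplierComponents]
  map_mul' x y := by
    funext i
    change D.p i (x.left (y.left (D.single i 1))) = _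
    rw [p_left]; rfl

theorem multiplierComponents_mul (x y : Multiplier A) (i : D.ι) :
    D.multiplierComponents (x * y) i =
      D.multiplierComponents x i * D.multiplierComponents y i :=
  congrFun (D.multiplierHom.map_mul x y) i

theorem multiplierComponents_one (i : D.ι) : D.multiplierComponents 1 i = 1 :=
  congrFun D.multiplierHom.map_one i

theorem multiplierComponents_star (x : Multiplier A) (i : D.ι) :
    D.multiplierComponents (star x) i = star (D.multiplierComponents x i) := by
  rw [multiplierComponents, Multiplier.star_left, map_star, p_right, star_mul, map_star,
    star_star, p_single_self, mul_one]

theorem exists_p_eq (f : ∀ i, Module.End ℂ (Matrix (Fin (D.n i)) (Fin (D.n i)) ℂ)) :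
    ∃ ψ : Module.End ℂ A, ∀ i a, D.p i (ψ a) = f i (D.p i a) := by
  have hex : ∀ a, ∃ b, ∀ i, D.p i b = f i (D.p i a) := fun a =>
    (D.existsUnique _ ((D.finite_support a).subset fun i hi h => hi (by rw [h, map_zero]))).exists
  choose ψ hψ using hex
  exact ⟨{ toFun := ψ
           map_add' := fun a b => D.ext fun i => by simp [hψ]
           map_smul' := fun r a => D.ext fun i => by simp [hψ] }, fun i a => hψ a i⟩

theorem multiplierComponents_surjective : Function.Surjective D.multiplierComponents := by
  intro y
  obtain ⟨ψ, hψ⟩ := D.exists_p_eq fun i => mulLeft ℂ (y i)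
  obtain ⟨χ, hχ⟩ := D.exists_p_eq fun i => mulRight ℂ (y i)
  refine ⟨Multiplier.mk' ψ χ (fun a b => D.ext fun i => ?_) (fun a b => D.ext fun i => ?_)
    (fun a b => D.ext fun i => ?_), funext fun i => ?_⟩
  · simp [hψ, mul_assoc]
  · simp [hχ, mul_assoc]
  · simp [hψ, hχ, mul_assoc]
  · change D.p i (ψ (D.single i 1)) = y i
    simp [hψ]

include D in
/-- Endomorphisms of the left regular representation are right multiplications by multipliers. -/
theorem exists_right_eq {s : Module.End ℂ A} (hs : s ∈ regularEnd A) :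
    ∃ r : Multiplier A, r.right = s := by
  obtain ⟨r, hr⟩ := D.multiplierComponents_surjective fun i => D.p i (s (D.single i 1))
  refine ⟨r, LinearMap.ext fun a => D.ext fun i => ?_⟩
  -- `Iᵢ` is central, so `Iᵢ s(a) = s(Iᵢ a) = s(a Iᵢ) = a s(Iᵢ)`; hence `s` is right multiplication
  -- by the family `s(Iᵢ)`.
  have h1 : D.single i 1 * a = a * D.single i 1 := D.ext fun j => by
    by_cases hj : j = i
    · subst hj; simp
    · simp [p_single_ne D hj]
  have h2 := congrArg (D.p i) (hs (D.single i 1) a)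
  rw [h1, hs a] at h2
  rw [p_right, hr]
  simpa using h2

theorem right_mem_regularEnd (x : Multiplier A) : x.right ∈ regularEnd A := x.right_mul'

theorem regularEndComponents_right (x : Multiplier A) (i : D.ι)
    (y : Matrix (Fin (D.n i)) (Fin (D.n i)) ℂ) :
    D.regularEndComponents ⟨x.right, right_mem_regularEnd x⟩ i y =
      y * D.multiplierComponents x i := by
  rw [regularEndComponents, p_right, p_single_self]

/-- The matrix coefficients on `A ⊗ A` separate points. -/
theorem tensor_ext {u v : A ⊗[ℂ] A}
    (h : ∀ i k l j k' l', D.p j (slice (Matrix.entryLinearMap ℂ ℂ k l ∘ₗ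
      (D.p i : A →ₗ[ℂ] Matrix (Fin (D.n i)) (Fin (D.n i)) ℂ)) u) k' l' =
      D.p j (slice (Matrix.entryLinearMap ℂ ℂ k l ∘ₗ
      (D.p i : A →ₗ[ℂ] Matrix (Fin (D.n i)) (Fin (D.n i)) ℂ)) v) k' l') : u = v := by
  rw [← sub_eq_zero]
  refine eq_zero_of_forall_lTensor
    (fun x : Σ i : D.ι, Fin (D.n i) × Fin (D.n i) => Matrix.entryLinearMap ℂ ℂ x.2.1 x.2.2 ∘ₗ
      (D.p x.1 : A →ₗ[ℂ] Matrix (Fin (D.n x.1)) (Fin (D.n x.1)) ℂ))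
    (fun w hw => D.ext fun i => ?_) _ fun x => lTensor_eq_zero_of_slice ?_
  · ext k l
    rw [map_zero]
    exact hw ⟨i, k, l⟩
  · rw [map_sub, sub_eq_zero]
    refine D.ext fun j => ?_
    ext k' l'
    exact h _ _ _ _ _ _

/-! ### Compactness of the intrinsic group -/

section Topology

/-- The multiplier with given components. -/
noncomputable def ofComponents (y : ∀ i, Matrix (Fin (D.n i)) (Fin (D.n i)) ℂ) : Multiplier A :=
  (D.multiplierComponents_surjective y).choose

@[simp] theorem multiplierComponents_ofComponents
    (y : ∀ i, Matrix (Fin (D.n i)) (Fin (D.n i)) ℂ) :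
    D.multiplierComponents (D.ofComponents y) = y :=
  (D.multiplierComponents_surjective y).choose_spec

@[simp] theorem ofComponents_multiplierComponents (x : Multiplier A) :
    D.ofComponents (D.multiplierComponents x) = x :=
  D.multiplierComponents_injective (D.multiplierComponents_ofComponents _)

/-- `D.single` as a linear map. -/
noncomputable def singleLinear (i : D.ι) : Matrix (Fin (D.n i)) (Fin (D.n i)) ℂ →ₗ[ℂ] A where
  toFun := D.single i
  map_add' y z := D.ext fun j => by
    by_cases hj : j = i
    · subst hj; simp
    · simp [p_single_ne D hj]
  map_smul' r y := D.ext fun j => by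
    by_cases hj : j = i
    · subst hj; simp
    · simp [p_single_ne D hj]

theorem eq_sum_single (a b : A) (h : ∀ i, D.p i b = 0 → D.p i a = 0) :
    a = ∑ i ∈ (D.finite_support b).toFinset, D.single i (D.p i a) := by
  refine D.ext fun j => ?_
  rw [map_sum]
  by_cases hj : j ∈ (D.finite_support b).toFinset
  · rw [Finset.sum_eq_single_of_mem j hj fun i _ hi => p_single_ne D hi.symm _, p_single_self]
  · rw [Finset.sum_eq_zero fun i hi => p_single_ne D (by rintro rfl; exact hj hi) _]
    exact h j (by simpa using hj)

/-- The product depends linearly on the finitely many `yᵢ` with `pᵢ(a) ≠ 0`, and linear maps on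
finite dimensional spaces are continuous. -/
theorem continuous_functional_left (Λ : A →ₗ[ℂ] ℂ) (a : A) :
    Continuous fun y => Λ ((D.ofComponents y).left a) := by
  have h1 : ∀ y, (D.ofComponents y).left a =
      ∑ i ∈ (D.finite_support a).toFinset, D.singleLinear i (y i * D.p i a) := by
    intro y
    rw [D.eq_sum_single ((D.ofComponents y).left a) a fun i hi => by rw [p_left, hi, mul_zero]]
    refine Finset.sum_congr rfl fun i _ => ?_
    rw [p_left, multiplierComponents_ofComponents]
    rfl
  simp only [h1, map_sum]
  refine continuous_finsetSum _ fun i _ => ?_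
  have h2 : Continuous (Λ ∘ₗ D.singleLinear i) := LinearMap.continuous_of_finiteDimensional _
  exact h2.comp ((continuous_apply i).matrix_mul continuous_const)

theorem continuous_tensor_left (z : A ⊗[ℂ] A) (i : D.ι) (k l : Fin (D.n i)) (j : D.ι)
    (k' l' : Fin (D.n j)) :
    Continuous fun y => D.p j (slice (Matrix.entryLinearMap ℂ ℂ k l ∘ₗ
      (D.p i : A →ₗ[ℂ] Matrix (Fin (D.n i)) (Fin (D.n i)) ℂ))
      ((Multiplier.tensor (D.ofComponents y) (D.ofComponents y)).left z)) k' l' := by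
  induction z with
  | zero => simpa using continuous_const
  | add x y hx hy =>
    simp only [map_add, Matrix.add_apply]
    exact hx.add hy
  | tmul a b =>
    simp only [Multiplier.tensor_left, TensorProduct.map_tmul, slice_tmul, map_smul,
      Matrix.smul_apply, p_left, multiplierComponents_ofComponents, LinearMap.comp_apply,
      smul_eq_mul]
    refine Continuous.mul ?_ ?_
    · have := D.continuous_functional_left (Matrix.entryLinearMap ℂ ℂ k l ∘ₗ
        (D.p i : A →ₗ[ℂ] Matrix (Fin (D.n i)) (Fin (D.n i)) ℂ)) b
      exact this
    · exact (((continuous_apply j).matrix_mul continuous_const).matrix_elem k' l')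

/-- Tested by matrix coefficients, `(g ⊗ g)Δ(a)z = Δ(ga)z` equates continuous functions of the
components of `g`. -/
theorem isClosed_comulEq (Q : AlgebraicQuantumGroup A) :
    IsClosed {y | Q.ComulEq (D.ofComponents y)
      (Multiplier.tensor (D.ofComponents y) (D.ofComponents y))} := by
  have h : {y | Q.ComulEq (D.ofComponents y)
      (Multiplier.tensor (D.ofComponents y) (D.ofComponents y))} =
      {y | ∀ a z i k l j k' l', D.p j (slice (Matrix.entryLinearMap ℂ ℂ k l ∘ₗ
      (D.p i : A →ₗ[ℂ] Matrix (Fin (D.n i)) (Fin (D.n i)) ℂ))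
      ((Multiplier.tensor (D.ofComponents y) (D.ofComponents y)).left ((Q.Δ a).left z))) k' l' =
      D.p j (slice (Matrix.entryLinearMap ℂ ℂ k l ∘ₗ
      (D.p i : A →ₗ[ℂ] Matrix (Fin (D.n i)) (Fin (D.n i)) ℂ))
      ((Q.Δ ((D.ofComponents y).left a)).left z)) k' l'} := by
    ext y
    refine ⟨fun hy a z i k l j k' l' => ?_, fun hy => ?_⟩
    · rw [← (hy a).1]; rfl
    · exact AlgebraicQuantumGroup.comulEq_of_left fun a z => D.tensor_ext (hy a z)
  rw [h]
  simp only [Set.ofPred_forall]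
  refine isClosed_iInter fun a => isClosed_iInter fun z => isClosed_iInter fun i =>
    isClosed_iInter fun k => isClosed_iInter fun l => isClosed_iInter fun j =>
    isClosed_iInter fun k' => isClosed_iInter fun l' => isClosed_eq
      (D.continuous_tensor_left _ i k l j k' l') ?_
  let Λ : A →ₗ[ℂ] ℂ :=
    { toFun := fun c => D.p j (slice (Matrix.entryLinearMap ℂ ℂ k l ∘ₗ
        (D.p i : A →ₗ[ℂ] Matrix (Fin (D.n i)) (Fin (D.n i)) ℂ)) ((Q.Δ c).left z)) k' l'
      map_add' := fun c d => by
        have : (Q.Δ (c + d)).left z = (Q.Δ c).left z + (Q.Δ d).left z := by rw [map_add]; rfl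
        rw [this, map_add, map_add, Matrix.add_apply]
      map_smul' := fun r c => by
        have : (Q.Δ (r • c)).left z = r • (Q.Δ c).left z := by rw [map_smul]; rfl
        rw [this, map_smul, map_smul, Matrix.smul_apply]; rfl }
  exact D.continuous_functional_left Λ a

/-- The homomorphism `G → ∏ᵢ End Hᵢ`. -/
noncomputable def intrinsicGroupHom (Q : AlgebraicQuantumGroup A) :
    Q.intrinsicGroup →* ∀ i, Matrix (Fin (D.n i)) (Fin (D.n i)) ℂ :=
  D.multiplierHom.comp ((unitary (Multiplier A)).subtype.comp Q.intrinsicGroup.subtype)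

theorem isInducing_intrinsicGroupHom (Q : AlgebraicQuantumGroup A) :
    letI := D.intrinsicGroupTopology Q
    Topology.IsInducing (D.intrinsicGroupHom Q) :=
  letI := D.intrinsicGroupTopology Q
  ⟨induced_compose⟩

theorem intrinsicGroupHom_inv (Q : AlgebraicQuantumGroup A) (g : Q.intrinsicGroup) :
    D.intrinsicGroupHom Q g⁻¹ = star (D.intrinsicGroupHom Q g) :=
  funext fun i => D.multiplierComponents_star _ i

theorem isTopologicalGroup_intrinsicGroup (Q : AlgebraicQuantumGroup A) :
    letI := D.intrinsicGroupTopology Q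
    IsTopologicalGroup Q.intrinsicGroup := by
  let := D.intrinsicGroupTopology Q
  have hi := D.isInducing_intrinsicGroupHom Q
  have : ContinuousMul Q.intrinsicGroup := hi.continuousMul _
  refine { continuous_inv := hi.continuous_iff.2 ?_ }
  have : D.intrinsicGroupHom Q ∘ Inv.inv = star ∘ D.intrinsicGroupHom Q :=
    funext fun g => D.intrinsicGroupHom_inv Q g
  rw [this]
  exact continuous_star.comp hi.continuous

theorem range_intrinsicGroupHom (Q : AlgebraicQuantumGroup A) :
    Set.range (D.intrinsicGroupHom Q) =
      {y | star y * y = 1} ∩ {y | y * star y = 1} ∩ {y | Q.ComulEq (D.ofComponents y)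
        (Multiplier.tensor (D.ofComponents y) (D.ofComponents y))} := by
  ext y
  constructor
  · rintro ⟨g, rfl⟩
    refine ⟨⟨?_, ?_⟩, ?_⟩
    · change star _ * _ = _
      rw [← intrinsicGroupHom_inv, ← MonoidHom.map_mul, inv_mul_cancel, MonoidHom.map_one]
    · change _ * star _ = _
      rw [← intrinsicGroupHom_inv, ← MonoidHom.map_mul, mul_inv_cancel, MonoidHom.map_one]
    · have : D.ofComponents (D.intrinsicGroupHom Q g) = ((g : unitary (Multiplier A)) :
          Multiplier A) := D.ofComponents_multiplierComponents _
      rw [Set.mem_ofPred_eq, this]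
      exact g.2
  · rintro ⟨⟨h1, h2⟩, h3⟩
    refine ⟨⟨⟨D.ofComponents y, ?_, ?_⟩, h3⟩, D.multiplierComponents_ofComponents y⟩
    · refine D.multiplierComponents_injective (funext fun i => ?_)
      rw [multiplierComponents_mul, multiplierComponents_star, multiplierComponents_ofComponents,
        multiplierComponents_one]
      exact congrFun h1 i
    · refine D.multiplierComponents_injective (funext fun i => ?_)
      rw [multiplierComponents_mul, multiplierComponents_star, multiplierComponents_ofComponents,
        multiplierComponents_one]
      exact congrFun h2 i

/-- The image of `G` is a closed subset of a product of compact sets, as the entries of a unitary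
matrix have modulus at most 1. -/
theorem compactSpace_intrinsicGroup (Q : AlgebraicQuantumGroup A) :
    letI := D.intrinsicGroupTopology Q
    CompactSpace Q.intrinsicGroup := by
  let := D.intrinsicGroupTopology Q
  have hi := D.isInducing_intrinsicGroupHom Q
  rw [← isCompact_univ_iff, hi.isCompact_iff, Set.image_univ]
  have hK : ∀ i, IsCompact {M : Matrix (Fin (D.n i)) (Fin (D.n i)) ℂ | ∀ k l, ‖M k l‖ ≤ 1} := by
    intro i
    have h1 : IsCompact (Set.univ.pi fun _ : Fin (D.n i) => Set.univ.pi fun _ : Fin (D.n i) =>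
        Metric.closedBall (0 : ℂ) 1) :=
      isCompact_univ_pi fun _ => isCompact_univ_pi fun _ => isCompact_closedBall _ _
    have h2 : {M : Matrix (Fin (D.n i)) (Fin (D.n i)) ℂ | ∀ k l, ‖M k l‖ ≤ 1} =
        Set.univ.pi fun _ => Set.univ.pi fun _ => Metric.closedBall (0 : ℂ) 1 := by
      ext M
      exact ⟨fun h k _ l _ => mem_closedBall_zero_iff.2 (h k l),
        fun h k l => mem_closedBall_zero_iff.1 (h k trivial l trivial)⟩
    rw [h2]
    exact h1
  refine (isCompact_univ_pi hK).of_isClosed_subset ?_ ?_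
  · rw [range_intrinsicGroupHom]
    refine (IsClosed.inter ?_ ?_).inter (D.isClosed_comulEq Q)
    · exact isClosed_eq (continuous_star.fun_mul continuous_id') continuous_const
    · exact isClosed_eq (continuous_id'.fun_mul continuous_star) continuous_const
  · rw [range_intrinsicGroupHom]
    rintro y ⟨⟨h1, h2⟩, -⟩ i - k l
    exact entry_norm_bound_of_unitary (U := y i) ⟨congrFun h1 i, congrFun h2 i⟩ k l

end Topology

end BlockDecomposition

/-! ### The isomorphism by right multiplications -/

namespace AlgebraicQuantumGroup

variable {A : Type u} [NonUnitalRing A] [Module ℂ A] [IsScalarTower ℂ A A] [SMulCommClass ℂ A A]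
  [StarRing A] [StarModule ℂ A] {Q : AlgebraicQuantumGroup A} {ε : A →ₙₐ[ℂ] ℂ} {h : A}
  {m : (A ⊗[ℂ] A) →ₗ[ℂ] A} {η : ℂ →ₗ[ℂ] A}

theorem IsRegularMonoid.φ_mul (hm : Q.IsRegularMonoid m η) (c : A) (z : A ⊗[ℂ] A) :
    Q.φ (c * m z) = mul' ℂ ℂ (TensorProduct.map Q.φ Q.φ ((Q.Δ c).left z)) :=
  LinearMap.congr_fun (LinearMap.congr_fun hm.1 z) c

theorem map_φ_tensor {x y : Multiplier A} (hxy : ∀ a, Q.φ (x.right a) = Q.φ (y.left a))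
    (z : A ⊗[ℂ] A) :
    mul' ℂ ℂ (TensorProduct.map Q.φ Q.φ ((Multiplier.tensor x x).right z)) =
      mul' ℂ ℂ (TensorProduct.map Q.φ Q.φ ((Multiplier.tensor y y).left z)) := by
  induction z with
  | zero => simp
  | add a b ha hb => simp only [map_add, ha, hb]
  | tmul a b => simp [Multiplier.tensor_left, Multiplier.tensor_right, hxy]

/-- If `φ(a r) = φ(g a)`, then right multiplication by `r` respects the regular monoid structure
if and only if `g` is group-like. -/
theorem IsRegularMonoid.comp_map_right_iff (hε : Q.IsCounit ε) (h0 : h ≠ 0)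
    (hh : ∀ a, a * h = ε a • h) (hm : Q.IsRegularMonoid m η) {r g : Multiplier A}
    (hrg : ∀ a, Q.φ (r.right a) = Q.φ (g.left a)) :
    m ∘ₗ TensorProduct.map r.right r.right = r.right ∘ₗ m ↔
      Q.ComulEq g (Multiplier.tensor g g) := by
  have h1 : ∀ c z, Q.φ (c * m (TensorProduct.map r.right r.right z)) =
      mul' ℂ ℂ (TensorProduct.map Q.φ Q.φ ((Multiplier.tensor g g * Q.Δ c).left z)) := by
    intro c z
    rw [hm.φ_mul, ← Multiplier.tensor_right, Q.left_right_comm, map_φ_tensor hrg]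
    rfl
  have h2 : ∀ c z, Q.φ (c * r.right (m z)) =
      mul' ℂ ℂ (TensorProduct.map Q.φ Q.φ ((Q.Δ (g.left c)).left z)) := by
    intro c z
    rw [← Multiplier.right_mul', hrg, Multiplier.left_mul', hm.φ_mul]
  constructor
  · intro H
    refine comulEq_of_left fun c z => sub_eq_zero.1 (eq_zero_of_map_φ hε h0 hh fun w => ?_)
    rw [sub_mul, ← Multiplier.mul_left, ← Multiplier.left_mul', ← Multiplier.left_mul', map_sub,
      map_sub, ← h1, ← h2, sub_eq_zero]
    exact congrArg (fun x => Q.φ (c * x)) (LinearMap.congr_fun H (z * w))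
  · intro H
    refine LinearMap.ext fun z => fourier_injective hε h0 hh (LinearMap.ext fun c => ?_)
    rw [fourier_apply, fourier_apply, comp_apply, comp_apply, h1, h2, (H c).1]

/-- If `φ(a r) = φ((r⁻¹)* a)`, then right multiplication by `r` is unitary. -/
theorem isAdjoint_right_iff (hε : Q.IsCounit ε) {r r' : Multiplier A} :
    Q.IsAdjoint r.right r'.right ↔ ∀ a, Q.φ (r.right a) = Q.φ ((star r').left a) := by
  have h1 : ∀ u v, star (r'.right v) * u = (star r').left (star v * u) := fun u v => by
    rw [Multiplier.left_mul', Multiplier.star_left, star_star]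
  constructor
  · intro H
    have : Q.φ ∘ₗ r.right = Q.φ ∘ₗ (star r').left := hε.linearMap_ext fun a b => by
      have := H b (star a)
      rw [h1, star_star, ← Multiplier.right_mul'] at this
      exact this
    exact LinearMap.congr_fun this
  · intro H u v
    rw [h1, ← Multiplier.right_mul', H]

/-- Right multiplication by `g⁻¹`. -/
def rightUnit (g : unitary (Multiplier A)) : (regularEnd A)ˣ where
  val := ⟨((g⁻¹ : unitary (Multiplier A)) : Multiplier A).right, Multiplier.right_mul' _⟩
  inv := ⟨(g : Multiplier A).right, Multiplier.right_mul' _⟩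
  val_inv := Subtype.ext <| LinearMap.ext fun a =>
    congrArg (fun x : unitary (Multiplier A) => (x : Multiplier A).right a) (mul_inv_cancel g)
  inv_val := Subtype.ext <| LinearMap.ext fun a =>
    congrArg (fun x : unitary (Multiplier A) => (x : Multiplier A).right a) (inv_mul_cancel g)

theorem rightUnit_val (g : unitary (Multiplier A)) :
    (((rightUnit g : (regularEnd A)ˣ) : regularEnd A) : Module.End ℂ A) =
      ((g⁻¹ : unitary (Multiplier A)) : Multiplier A).right := rfl

/-- Right multiplication reverses products; the inverse in `rightUnit` reverses them back. -/
theorem rightUnit_mul (g k : unitary (Multiplier A)) :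
    rightUnit (g * k) = rightUnit g * rightUnit k := by
  refine Units.ext (Subtype.ext (LinearMap.ext fun a => ?_))
  rw [rightUnit_val, mul_inv_rev]
  rfl

theorem rightUnit_mem (hε : Q.IsCounit ε) (h0 : h ≠ 0) (hh : ∀ a, a * h = ε a • h)
    (hh' : ∀ a, h * a = ε a • h) (h1 : ε h = 1) (hm : Q.IsRegularMonoid m η)
    (g : Q.intrinsicGroup) : rightUnit (g : unitary (Multiplier A)) ∈ Q.regularIntrinsicGroup m := by
  have hcomm := φ_grouplike_comm hε h0 hh hh' h1 (g⁻¹).2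
    (congrArg (fun x : Q.intrinsicGroup => ((x : unitary (Multiplier A)) : Multiplier A))
      (inv_mul_cancel g))
    (congrArg (fun x : Q.intrinsicGroup => ((x : unitary (Multiplier A)) : Multiplier A))
      (mul_inv_cancel g))
  exact ⟨(isAdjoint_right_iff hε).2 fun a => (hcomm a).symm,
    (hm.comp_map_right_iff hε h0 hh fun a => (hcomm a).symm).2 (g⁻¹).2⟩

/-- The homomorphism `G → G_{π_l}`, which maps `g` to the right multiplication by `g⁻¹`. -/
noncomputable def intrinsicGroupToRegular (hε : Q.IsCounit ε) (h0 : h ≠ 0) (hh : ∀ a, a * h = ε a • h)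
    (hh' : ∀ a, h * a = ε a • h) (h1 : ε h = 1) (hm : Q.IsRegularMonoid m η) :
    Q.intrinsicGroup →* Q.regularIntrinsicGroup m :=
  MonoidHom.mk' (fun g => ⟨rightUnit g, rightUnit_mem hε h0 hh hh' h1 hm g⟩)
    fun _ _ => Subtype.ext (rightUnit_mul _ _)

theorem intrinsicGroupToRegular_bijective (hε : Q.IsCounit ε) (h0 : h ≠ 0)
    (hh : ∀ a, a * h = ε a • h) (hh' : ∀ a, h * a = ε a • h) (h1 : ε h = 1)
    (hm : Q.IsRegularMonoid m η) (D : BlockDecomposition A) :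
    Function.Bijective (intrinsicGroupToRegular hε h0 hh hh' h1 hm) := by
  have right_inj : ∀ x y : Multiplier A, x.right = y.right → x = y := fun x y hxy =>
    Multiplier.ext' (fun b => Q.ext_mul_left fun c => by
      rw [← Multiplier.central, ← Multiplier.central, hxy]) fun b => by rw [hxy]
  constructor
  · intro g k hgk
    have h2 : rightUnit (g : unitary (Multiplier A)) = rightUnit (k : unitary (Multiplier A)) :=
      congrArg Subtype.val hgk
    have h3 := congrArg (fun u : (regularEnd A)ˣ => ((u⁻¹ : (regularEnd A)ˣ) : regularEnd A)) h2
    exact Subtype.ext (Subtype.ext (right_inj _ _ (congrArg Subtype.val h3)))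
  · rintro ⟨t, ht1, ht2⟩
    obtain ⟨r, hr⟩ := D.exists_right_eq (t : regularEnd A).2
    obtain ⟨r', hr'⟩ := D.exists_right_eq ((t⁻¹ : (regularEnd A)ˣ) : regularEnd A).2
    have hrr' : r * r' = 1 := right_inj _ _ <| LinearMap.ext fun a => by
      rw [Multiplier.mul_right, hr, hr']
      exact congrArg (fun s : regularEnd A => (s : Module.End ℂ A) a) t.inv_mul
    have hr'r : r' * r = 1 := right_inj _ _ <| LinearMap.ext fun a => by
      rw [Multiplier.mul_right, hr, hr']
      exact congrArg (fun s : regularEnd A => (s : Module.End ℂ A) a) t.mul_inv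
    rw [← hr, ← hr', isAdjoint_right_iff hε] at ht1
    rw [← hr, hm.comp_map_right_iff hε h0 hh ht1] at ht2
    have hcomm := φ_grouplike_comm hε h0 hh hh' h1 ht2 (g' := star r)
      (by rw [← star_mul, hrr', star_one]) (by rw [← star_mul, hr'r, star_one])
    -- `φ(ar) = φ(r'* a) = φ(a r'*)` by centrality for the group-like `r'*`, and `φ` is faithful.
    have hrs : r = star r' := right_inj _ _ <| LinearMap.ext fun a => by
      rw [← sub_eq_zero]
      refine eq_zero_of_mul_φ hε h0 hh fun y => ?_
      rw [mul_sub, ← Multiplier.right_mul', ← Multiplier.right_mul', map_sub, ht1, hcomm, sub_self]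
    rw [← hrs] at ht2
    have hsr : star r = r' := by rw [hrs, star_star]
    have hu : r ∈ unitary (Multiplier A) := ⟨by rw [hsr, hr'r], by rw [hsr, hrr']⟩
    refine ⟨(⟨⟨r, hu⟩, ht2⟩ : Q.intrinsicGroup)⁻¹, Subtype.ext (Units.ext (Subtype.ext ?_))⟩
    rw [← hr]
    change (((((⟨⟨r, hu⟩, ht2⟩ : Q.intrinsicGroup)⁻¹ : Q.intrinsicGroup) :
      unitary (Multiplier A))⁻¹ : unitary (Multiplier A)) : Multiplier A).right = r.right
    rw [InvMemClass.coe_inv, inv_inv]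

end AlgebraicQuantumGroup

/-! ### The isomorphism is a homeomorphism -/

namespace BlockDecomposition

variable {A : Type u} [NonUnitalRing A] [Module ℂ A] [IsScalarTower ℂ A A] [SMulCommClass ℂ A A]
  [StarRing A] [StarModule ℂ A] (D : BlockDecomposition A) {Q : AlgebraicQuantumGroup A}
  {m : (A ⊗[ℂ] A) →ₗ[ℂ] A}

theorem isTopologicalGroup_and_nonempty_continuousMulEquiv
    (f : Q.intrinsicGroup →* Q.regularIntrinsicGroup m) (hf : Function.Bijective f)
    (hfr : ∀ g, (f g : (regularEnd A)ˣ) =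
      AlgebraicQuantumGroup.rightUnit (g : unitary (Multiplier A))) :
    letI : TopologicalSpace Q.intrinsicGroup := D.intrinsicGroupTopology Q
    letI : TopologicalSpace (Q.regularIntrinsicGroup m) := D.regularIntrinsicGroupTopology Q m
    IsTopologicalGroup (Q.regularIntrinsicGroup m) ∧
      Nonempty (Q.intrinsicGroup ≃ₜ* Q.regularIntrinsicGroup m) := by
  let : TopologicalSpace Q.intrinsicGroup := D.intrinsicGroupTopology Q
  let : TopologicalSpace (Q.regularIntrinsicGroup m) := D.regularIntrinsicGroupTopology Q m
  let : TopologicalSpace (regularEnd A) := D.regularEndTopology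
  have := D.isTopologicalGroup_intrinsicGroup Q
  have hi := D.isInducing_intrinsicGroupHom Q
  have hreg : Topology.IsInducing fun t : Q.regularIntrinsicGroup m =>
      D.regularEndComponents ((t : (regularEnd A)ˣ) : regularEnd A) := ⟨induced_compose⟩
  have hcomp : ∀ g i y, D.regularEndComponents ((f g : (regularEnd A)ˣ) : regularEnd A) i y =
      y * D.intrinsicGroupHom Q g⁻¹ i := fun g i y => by
    rw [hfr]
    exact D.regularEndComponents_right _ i y
  let e : Q.intrinsicGroup ≃* Q.regularIntrinsicGroup m := MulEquiv.ofBijective f hf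
  have he : Continuous e := hreg.continuous_iff.2 <| continuous_pi fun i => continuous_pi fun y => by
    have : (fun g => D.regularEndComponents ((f g : (regularEnd A)ˣ) : regularEnd A) i y) =
        fun g => y * D.intrinsicGroupHom Q g⁻¹ i := funext fun g => hcomp g i y
    change Continuous fun g => D.regularEndComponents ((f g : (regularEnd A)ˣ) : regularEnd A) i y
    rw [this]
    exact continuous_const.matrix_mul
      ((continuous_apply i).comp (hi.continuous.comp continuous_inv))
  -- The value at `y = 1` of the `i`-th component is `gᵢ*`, so `g` is recovered continuously.
  have he' : Continuous e.symm := hi.continuous_iff.2 <| continuous_pi fun i => by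
    have : (fun t => D.intrinsicGroupHom Q (e.symm t) i) = fun t =>
        star (D.regularEndComponents (((t : Q.regularIntrinsicGroup m) : (regularEnd A)ˣ) :
          regularEnd A) i 1) := funext fun t => by
      obtain ⟨g, rfl⟩ := e.surjective t
      rw [e.symm_apply_apply]
      change _ = star (D.regularEndComponents ((f g : (regularEnd A)ˣ) : regularEnd A) i 1)
      rw [hcomp, one_mul, D.intrinsicGroupHom_inv, Pi.star_apply, star_star]
    change Continuous fun t => D.intrinsicGroupHom Q (e.symm t) i
    rw [this]
    exact continuous_star.comp
      (continuous_pi_iff.1 (continuous_pi_iff.1 hreg.continuous i) 1)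
  let E : Q.intrinsicGroup ≃ₜ* Q.regularIntrinsicGroup m :=
    { e with continuous_toFun := he, continuous_invFun := he' }
  exact ⟨E.symm.toHomeomorph.isInducing.topologicalGroup E.symm, ⟨E⟩⟩

end BlockDecomposition

theorem mainTheorem7 {A : Type u} [NonUnitalRing A] [Module ℂ A] [IsScalarTower ℂ A A]
    [SMulCommClass ℂ A A] [StarRing A] [StarModule ℂ A]
    (Q : AlgebraicQuantumGroup A) (hQ : Q.IsDiscrete) :
    Nonempty (BlockDecomposition A) ∧
    (∃! mη : ((A ⊗[ℂ] A) →ₗ[ℂ] A) × (ℂ →ₗ[ℂ] A), Q.IsRegularMonoid mη.1 mη.2) ∧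
    ∀ (m : (A ⊗[ℂ] A) →ₗ[ℂ] A) (η : ℂ →ₗ[ℂ] A), Q.IsRegularMonoid m η →
      ∀ D : BlockDecomposition A,
        letI : TopologicalSpace Q.intrinsicGroup := D.intrinsicGroupTopology Q
        letI : TopologicalSpace (Q.regularIntrinsicGroup m) := D.regularIntrinsicGroupTopology Q m
        IsTopologicalGroup Q.intrinsicGroup ∧ CompactSpace Q.intrinsicGroup ∧
          IsTopologicalGroup (Q.regularIntrinsicGroup m) ∧
          Nonempty (Q.intrinsicGroup ≃ₜ* Q.regularIntrinsicGroup m) := by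
  obtain ⟨ε, h, hε, h0, hh, hh', h1, -⟩ := hQ.exists_integral
  refine ⟨exists_blockDecomposition (AlgebraicQuantumGroup.core hε h0 hh) (fun _ _ => rfl)
      (AlgebraicQuantumGroup.finiteDimensional_range_mulRight hε h0 hh),
    AlgebraicQuantumGroup.existsUnique_regularMonoid hε h0 hh, fun m η hm D => ?_⟩
  exact ⟨D.isTopologicalGroup_intrinsicGroup Q, D.compactSpace_intrinsicGroup Q,
    D.isTopologicalGroup_and_nonempty_continuousMulEquiv
      (AlgebraicQuantumGroup.intrinsicGroupToRegular hε h0 hh hh' h1 hm)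
      (AlgebraicQuantumGroup.intrinsicGroupToRegular_bijective hε h0 hh hh' h1 hm D)
      fun _ => rfl⟩
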